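/- \textbf{Setup.} Let $\lambda$ be a $\sigma$-finite measure on a measurable space $\mathcal X$ and let $f,g$ be probability densities with respect to $\lambda$ whose Kullback--Leibler information number satisfies $$0<\mathcal I=\int \log\!\Big(\frac{g(x)}{f(x)}\Big)\,g(x)\,\lambda(dx)<\infty .$$ There are $K$ sensors, of which those in $\mathcal N\subseteq[K]$, $|\mathcal N|=K-M$, are honest and the other $M\ge 0$ are corrupt; $X^k_t$ is the observation in sensor $k$ at time $t\in\{1,2,\dots\}$. Let $\mathcal B\subseteq\mathcal N$ and $\nu\in\{0,1,\dots\}\cup\{\infty\}$. All observations in the honest sensors are independent; $X_t^k$ has density $g$ if $k\in\mathcal B$ and $t>\nu$, and density $f$ otherwise. A strategy of the adversary is a sequence $\pi=(\pi_t)_{t\ge1}$ of measurable functions, and the observations in the corrupt sensors at time $t$ are $X_t^{\mathcal N^c}=\pi_t(X_s^{\mathcal N},\,1\le s\le t)$. Expectation is denoted by $\mathsf E_\nu^{\mathcal B,\pi}$, by $\mathsf E_\infty^{\pi}$ if $\nu=\infty$ (no change), and by $\mathsf E_\infty$ if moreover only honest sensors are involved. Let $\mathcal F_t=\sigma(X_s^k:1\le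 s\le t,\,k\in[K])$. For an $\{\mathcal F_t\}$-stopping time $T$ put $$\mathcal A[T]=\inf_\pi \mathsf E_\infty^{\pi}[T],\qquad \mathcal J_{\mathcal B}[T]=\sup_{\nu<\infty,\ \pi}\ \operatorname{ess\,sup}\ \mathsf E_\nu^{\mathcal B,\pi}\big[(T-\nu)^+\,\big|\,\mathcal F_\nu\big],$$ and let $\mathcal C_\gamma$ be the class of all $\{\mathcal F_t\}$-stopping times $T$ with $\mathcal A[T]\ge\gamma$. The local CUSUM statistics are $Y_0^k=0$, $Y_t^k=\big(Y_{t-1}^k+\log\frac{g(X_t^k)}{f(X_t^k)}\big)^+$, with values in $[0,\infty]$. For $h>0$, let $\widetilde T_L(h)$ be the first time $t\ge1$ at which the sum of the $L$ smallest among the $K$ statistics $Y_t^k$, $k\in[K]$, is at least $h$, and let $\widetilde S_L(h)$ be the first time $t\ge 1$ at which the sum of the $L$ smallest among the $K-M$ statistics $Y_t^k$, $k\in\mathcal N$, is at least $h$. \textbf{Theorem.} Suppose $1\le L\le K-M$. Let $\Gamma$ be a set of real numbers and, for each $\gamma\in\Gamma$, let $h_\gamma>0$ be such that $\mathsf E_\infty[\widetilde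 S_L(h_\gamma)]=\gamma$. Then $\widetilde T_L(h_\gamma)\in\mathcal C_\gamma$ for every $\gamma\in\Gamma$. If also $L>K-|\mathcal B|$, then, as $\gamma\to\infty$ in $\Gamma$, $$\mathcal J_{\mathcal B}\big[\widetilde T_L(h_\gamma)\big]\ \sim\ \frac{L}{K-M}\cdot\frac{\log\gamma}{\big(|\mathcal B|-(K-L)\big)\,\mathcal I},$$ that is, the ratio of the two sides tends to $1$. -/

import Mathlib

open MeasureTheory Filter Topology
open scoped ENNReal NNReal

noncomputable section

namespace ByzantineCUSUM

variable {𝒳 : Type*} [MeasurableSpace 𝒳] {K : ℕ}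

/-- The probability measure with density `p` with respect to `lam`. -/
def densityMeasure (lam : Measure 𝒳) (p : 𝒳 → ℝ≥0) : Measure 𝒳 :=
  lam.withDensity fun x => (p x : ℝ≥0∞)

/-- The Kullback-Leibler information number `∫ log (g / f) g dlam`, as an extended nonnegative
real. -/
def klNumber (lam : Measure 𝒳) (f g : 𝒳 → ℝ≥0) : ℝ≥0∞ :=
  InformationTheory.klDiv (densityMeasure lam g) (densityMeasure lam f)

/-- The log-likelihood ratio `log (g x / f x)` of one observation. It is extended-real valued,
since the densities may vanish: it is `-∞` where `g x = 0`, and `+∞` where `f x = 0 < g x`. -/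
def logLR (f g : 𝒳 → ℝ≥0) (x : 𝒳) : EReal :=
  ENNReal.log ((g x : ℝ≥0∞) / (f x : ℝ≥0∞))

/-- The CUSUM statistic of a sequence of observations: `Y 0 = 0`,
`Y (t + 1) = (Y t + ℓ (t + 1))⁺`. Throughout, the coordinate `x t` of a sequence `x : ℕ → _`
is the observation at time `t + 1`, so that the observation times are `1, 2, …`. -/
def cusum (f g : 𝒳 → ℝ≥0) (x : ℕ → 𝒳) : ℕ → EReal
  | 0 => 0
  | t + 1 => max (cusum f g x t + logLR f g (x t)) 0

/-- The sum of the `L` smallest of the values `y i`: the values are listed in increasing order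
and the first `L` of them are added. -/
def sumSmallest {ι : Type*} [Fintype ι] (L : ℕ) (y : ι → EReal) : EReal :=
  (((Finset.univ.val.map y).sort (· ≤ ·)).take L).sum

/-- The Low-Sum-CUSUM rule based on the sensors in `ι`, as a function of their observations: the
first time `t ≥ 1` at which the sum of the `L` smallest local CUSUM statistics is at least `h`
(`⊤` if there is no such time). -/
def lowSumCusum {ι : Type*} [Fintype ι] (f g : 𝒳 → ℝ≥0) (L : ℕ) (h : ℝ)
    (x : ℕ → ι → 𝒳) : ℕ∞ :=
  ⨅ (t : ℕ) (_ : 1 ≤ t ∧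
    (h : EReal) ≤ sumSmallest L fun k => cusum f g (fun s => x s k) t), (t : ℕ∞)

/-- The law of the observations in the honest sensors `N` when the change occurs at time `nu` in
the subset `B`: all observations are independent, with density `g` in the sensors of `B` after
time `nu`, and with density `f` otherwise. If `nu = ⊤`, there is no change. -/
def honestLaw (lam : Measure 𝒳) (f g : 𝒳 → ℝ≥0) (N B : Finset (Fin K)) (nu : ℕ∞) :
    Measure (ℕ → N → 𝒳) :=
  Measure.infinitePi fun t : ℕ => Measure.pi fun k : N =>
    if (k : Fin K) ∈ B ∧ nu < ((t + 1 : ℕ) : ℕ∞) then densityMeasure lam g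
    else densityMeasure lam f

/-- A strategy of the adversary that controls the sensors outside `N`: for every time `t + 1`, a
measurable function that turns the observations of the honest sensors up to and including that
time into the observations of the corrupt sensors at that time. -/
structure Strategy (𝒳 : Type*) [MeasurableSpace 𝒳] {K : ℕ} (N : Finset (Fin K)) where
  act : ∀ t : ℕ, (Fin (t + 1) → N → 𝒳) → ({k : Fin K // k ∉ N} → 𝒳)
  measurable_act : ∀ t, Measurable (act t)

/-- The observations of all sensors, given those of the honest sensors and the strategy of the
adversary. -/
def observe {N : Finset (Fin K)} (π : Strategy 𝒳 N) (x : ℕ → N → 𝒳) : ℕ → Fin K → 𝒳 :=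
  fun t k => if hk : k ∈ N then x t ⟨k, hk⟩ else π.act t (fun s => x s) ⟨k, hk⟩

lemma measurable_observe {N : Finset (Fin K)} (π : Strategy 𝒳 N) : Measurable (observe π) := by
  refine measurable_pi_lambda _ fun t => measurable_pi_lambda _ fun k => ?_
  by_cases hk : k ∈ N
  · simp only [observe, hk, dite_true]
    fun_prop
  · simp only [observe, hk, dite_false]
    exact (measurable_pi_apply _).comp ((π.measurable_act t).comp (by fun_prop))

/-- The law of the observations in all `K` sensors when the change occurs at time `nu` in the
subset `B` of honest sensors and the strategy of the adversary is `π`. -/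
def sensorLaw (lam : Measure 𝒳) (f g : 𝒳 → ℝ≥0) (N B : Finset (Fin K)) (nu : ℕ∞)
    (π : Strategy 𝒳 N) : Measure (ℕ → Fin K → 𝒳) :=
  (honestLaw lam f g N B nu).map (observe π)

/-- The filtration generated by the observations in all sensors: the `σ`-algebra at time `t` is
generated by the observations at the times `1, …, t`. -/
def obsFiltration (𝒳 : Type*) [MeasurableSpace 𝒳] (K : ℕ) :
    Filtration ℕ (inferInstance : MeasurableSpace (ℕ → Fin K → 𝒳)) where
  seq t := MeasurableSpace.comap (fun (x : ℕ → Fin K → 𝒳) (s : Fin t) => x s) inferInstance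
  mono' := by
    intro a b hab
    have hm : Measurable fun (y : Fin b → Fin K → 𝒳) (s : Fin a) => y (Fin.castLE hab s) := by
      fun_prop
    rintro _ ⟨S, hS, rfl⟩
    exact ⟨_, hm hS, rfl⟩
  le' := by
    intro t
    exact Measurable.comap_le (by fun_prop)

/-- The worst-case expected time to false alarm of `T`: the infimum over all strategies of the
adversary of the expectation of `T` when there is no change. -/
def falseAlarmTime (lam : Measure 𝒳) (f g : 𝒳 → ℝ≥0) (N : Finset (Fin K))
    (T : (ℕ → Fin K → 𝒳) → ℕ∞) : ℝ≥0∞ :=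
  ⨅ π : Strategy 𝒳 N, ∫⁻ x, (T x : ℝ≥0∞) ∂(sensorLaw lam f g N ∅ ⊤ π)

/-- The class of sequential change-detection rules (stopping times of the observation filtration)
whose worst-case expected time to false alarm is at least `γ`. -/
def ruleClass (lam : Measure 𝒳) (f g : 𝒳 → ℝ≥0) (N : Finset (Fin K)) (γ : ℝ) :
    Set ((ℕ → Fin K → 𝒳) → ℕ∞) :=
  {T | IsStoppingTime (obsFiltration 𝒳 K) T ∧
    ENNReal.ofReal γ ≤ falseAlarmTime lam f g N T}

/-- The worst-case detection delay of `T` when the affected subset is `B`: the supremum, over all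
change-points and all strategies of the adversary, of the essential supremum of the conditional
expectation of `(T - nu)⁺` given the observations up to the change-point `nu`. -/
def detectionDelay (lam : Measure 𝒳) (f g : 𝒳 → ℝ≥0) (N B : Finset (Fin K))
    (T : (ℕ → Fin K → 𝒳) → ℕ∞) : ℝ≥0∞ :=
  ⨆ (nu : ℕ) (π : Strategy 𝒳 N),
    essSup (condLExp (obsFiltration 𝒳 K nu) (sensorLaw lam f g N B nu π)
        fun x => ((T x - (nu : ℕ∞) : ℕ∞) : ℝ≥0∞))
      (sensorLaw lam f g N B nu π)

end ByzantineCUSUM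

end

/-! Write n = |N|, r = |B| - (K - L), and Λ = g/f. Adding sensors can only lower the sum of the L
smallest statistics, so the rule run on the honest sensors alone stops no later than the full rule,
whatever the adversary does. This gives the false alarm constraint pathwise. The asymptotics follow
from two facts: log γ ~ (n/L) h, and the worst delay is ~ h/(r I).

Lower bound for log γ: if the L smallest of n statistics sum to at least h, then all n sum to at
least (n/L) h. Exponentials of CUSUM statistics have θ-moments under f bounded uniformly in time for
each θ < 1, so Markov's inequality, independence of the sensors and a union bound make alarms before
exp(θ n h/L) unlikely (`exists_le_lintegral_lowSumCusum`). Upper bound: cut time into blocks of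
length about h/(L I). An alarm is certain once every honest sensor has block likelihood ratio at
least exp(h/L). Change of measure shows that this costs about exp(-h/L) per sensor, and independent
blocks give a geometric waiting time (`exists_lintegral_lowSumCusum_le`).

Upper bound for the delay: any L sensors include at least r of B, so statistics above h/r throughout
B force an alarm. By the law of large numbers a block of length about h/(r I) achieves this with
probability near 1, independently of the past (`exists_detectionDelay_le`). Lower bound: let the
change be at 0 and let the corrupt sensors repeat a point with Λ ≤ 1, so that their statistics stay
at 0. The complement of B together with r sensors of B has L elements; its unaffected sensors
contribute little, and each of the r others grows at rate I, so h is not reached much before h/(r I)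
(`eventually_le_detectionDelay`). Each bound loses a factor depending on a slack δ, which finally
tends to 0. -/

namespace ByzantineCUSUM

/-! ### The sum of the L smallest values as a minimum over L-subsets. -/

section SumSmallest

variable {ι : Type*} [Fintype ι] {L : ℕ}

/-- Sorting the indices by value, rather than the values, breaks ties and yields an actual set of
sensors: the first L indices. -/
lemma exists_finset_sum_eq_sumSmallest (hL : L ≤ Fintype.card ι) (y : ι → EReal) :
    ∃ U : Finset ι, U.card = L ∧ ∑ i ∈ U, y i = sumSmallest L y ∧
      ∀ i ∈ U, ∀ j ∉ U, y i ≤ y j := by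
  classical
  set l := (Finset.univ : Finset ι).toList.mergeSort (fun i j => decide (y i ≤ y j)) with hl
  have hperm : l.Perm (Finset.univ : Finset ι).toList := List.mergeSort_perm _ _
  have hsort : l.Pairwise (fun i j => y i ≤ y j) := by
    have := List.pairwise_mergeSort (le := fun i j : ι => decide (y i ≤ y j))
      (fun a b c hab hbc => by simpa using (by simpa using hab : y a ≤ y b).trans (by simpa using hbc))
      (fun a b => by simpa using le_total (y a) (y b)) (Finset.univ : Finset ι).toList
    exact this.imp (by simp)
  have hnodup : l.Nodup := hperm.nodup_iff.2 (Finset.nodup_toList _)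
  have hlen : l.length = Fintype.card ι := by rw [hperm.length_eq]; simp
  have hmap : (Finset.univ.val.map y).sort (· ≤ ·) = l.map y := by
    refine List.Perm.eq_of_pairwise' (r := (· ≤ ·)) (Multiset.pairwise_sort _ _)
      (List.pairwise_map.2 hsort) ?_
    rw [← Multiset.coe_eq_coe, Multiset.sort_eq, ← Multiset.map_coe, Multiset.coe_eq_coe.2 hperm,
      Finset.coe_toList]
  have htake : (l.take L).Nodup := hnodup.sublist (List.take_sublist _ _)
  refine ⟨(l.take L).toFinset, ?_, ?_, ?_⟩
  · rw [List.toFinset_card_of_nodup htake, List.length_take, hlen, min_eq_left hL]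
  · rw [List.sum_toFinset _ htake, sumSmallest, hmap, List.map_take]
  · intro i hi j hj
    rw [List.mem_toFinset] at hi hj
    have hjl : j ∈ l := hperm.mem_iff.2 (by simp)
    rw [← List.take_append_drop L l] at hjl hsort
    exact (List.pairwise_append.1 hsort).2.2 i hi j ((List.mem_append.1 hjl).resolve_left hj)

/-- Exchange argument: `U \ s` and `s \ U` have equal size, and the largest value on the first is at
most every value on the second. The common part is kept on both sides, which avoids subtraction in
`EReal`. -/
lemma sumSmallest_le_sum (y : ι → EReal) {s : Finset ι} (hs : s.card = L) :
    sumSmallest L y ≤ ∑ i ∈ s, y i := by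
  classical
  obtain ⟨U, hUc, hUs, hU⟩ := exists_finset_sum_eq_sumSmallest (hs ▸ s.card_le_univ) y
  rw [← hUs, ← Finset.sum_inter_add_sum_sdiff U s, ← Finset.sum_inter_add_sum_sdiff s U,
    Finset.inter_comm s U]
  refine add_le_add le_rfl ?_
  have hcard : (U \ s).card = (s \ U).card := Finset.card_sdiff_comm (hUc.trans hs.symm)
  rcases (U \ s).eq_empty_or_nonempty with he | hne
  · have : s \ U = ∅ := by rw [← Finset.card_eq_zero, ← hcard, he, Finset.card_empty]
    rw [he, this]
  · obtain ⟨v, hv, hmax⟩ := Finset.exists_max_image _ y hne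
    refine (Finset.sum_le_card_nsmul _ _ (y v) hmax).trans ?_
    rw [hcard]
    refine Finset.card_nsmul_le_sum _ _ _ fun j hj => ?_
    exact hU v (Finset.mem_sdiff.1 hv).1 j (Finset.mem_sdiff.1 hj).2

/-- The mean of the L smallest values is at most the overall mean, multiplied out. The largest value
in `U` separates `U` from its complement. -/
lemma card_nsmul_sumSmallest_le (hL : L ≤ Fintype.card ι) (y : ι → EReal) :
    Fintype.card ι • sumSmallest L y ≤ L • ∑ i, y i := by
  classical
  obtain ⟨U, hUc, hUs, hU⟩ := exists_finset_sum_eq_sumSmallest hL y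
  rcases U.eq_empty_or_nonempty with rfl | hne
  · rw [← hUs, ← hUc]; simp
  obtain ⟨v, hv, hmax⟩ := Finset.exists_max_image _ y hne
  have hcompl : Uᶜ.card = Fintype.card ι - L := by rw [Finset.card_compl, hUc]
  have h1 : ∑ i ∈ U, y i ≤ L • y v := hUc ▸ Finset.sum_le_card_nsmul _ _ (y v) hmax
  have h2 : (Fintype.card ι - L) • y v ≤ ∑ i ∈ Uᶜ, y i := by
    rw [← hcompl]
    exact Finset.card_nsmul_le_sum _ _ _ fun j hj => hU v hv j (Finset.mem_compl.1 hj)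
  have h3 : (Fintype.card ι - L) • ∑ i ∈ U, y i ≤ L • ∑ i ∈ Uᶜ, y i := by
    calc _ ≤ (Fintype.card ι - L) • (L • y v) := nsmul_le_nsmul_right h1 _
      _ = L • ((Fintype.card ι - L) • y v) := smul_comm _ _ _
      _ ≤ _ := nsmul_le_nsmul_right h2 _
  calc Fintype.card ι • sumSmallest L y
      = L • ∑ i ∈ U, y i + (Fintype.card ι - L) • ∑ i ∈ U, y i := by
        rw [← add_nsmul, hUs, Nat.add_sub_cancel' hL]
    _ ≤ L • ∑ i ∈ U, y i + L • ∑ i ∈ Uᶜ, y i := by gcongr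
    _ = _ := by rw [← nsmul_add, Finset.sum_add_sum_compl]

/-- By inclusion-exclusion the minimizing set meets `s` in at least L + |s| - |ι| points;
nonnegativity discards the others. -/
lemma nsmul_le_sumSmallest (hL : L ≤ Fintype.card ι) {y : ι → EReal} (hy : ∀ i, 0 ≤ y i)
    {s : Finset ι} {c : EReal} (hc : 0 ≤ c) (hs : ∀ i ∈ s, c ≤ y i) :
    (L + s.card - Fintype.card ι) • c ≤ sumSmallest L y := by
  classical
  obtain ⟨U, hUc, hUs, -⟩ := exists_finset_sum_eq_sumSmallest hL y
  have hcard : L + s.card - Fintype.card ι ≤ (U ∩ s).card := by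
    have h1 := Finset.card_union_add_card_inter U s
    have h2 := (U ∪ s).card_le_univ
    omega
  rw [← hUs]
  calc _ ≤ (U ∩ s).card • c := nsmul_le_nsmul_left hc hcard
    _ ≤ ∑ i ∈ U ∩ s, y i :=
      Finset.card_nsmul_le_sum _ _ _ fun j hj => hs j (Finset.mem_inter.1 hj).2
    _ ≤ ∑ i ∈ U, y i :=
      Finset.sum_le_sum_of_subset_of_nonneg Finset.inter_subset_left fun i _ _ => hy i

lemma le_sumSmallest_iff (hL : L ≤ Fintype.card ι) (y : ι → EReal) (h : EReal) :
    h ≤ sumSmallest L y ↔ ∀ s : Finset ι, s.card = L → h ≤ ∑ i ∈ s, y i := by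
  refine ⟨fun hh s hs => hh.trans (sumSmallest_le_sum y hs), fun hh => ?_⟩
  obtain ⟨U, hUc, hUs, -⟩ := exists_finset_sum_eq_sumSmallest hL y
  exact hUs ▸ hh U hUc

lemma sumSmallest_le_sumSmallest_comp {κ : Type*} [Fintype κ] (hL : L ≤ Fintype.card κ)
    {e : κ → ι} (he : Function.Injective e) (y : ι → EReal) :
    sumSmallest L y ≤ sumSmallest L (y ∘ e) := by
  rw [le_sumSmallest_iff hL]
  intro s hs
  have := sumSmallest_le_sum y (s := s.map ⟨e, he⟩) ((Finset.card_map _).trans hs)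
  rwa [Finset.sum_map] at this

end SumSmallest

/-! ### Passage from sums of CUSUM statistics to products of their exponentials. -/

lemma log_finset_prod {ι : Type*} (s : Finset ι) (a : ι → ℝ≥0∞) :
    ENNReal.log (∏ i ∈ s, a i) = ∑ i ∈ s, ENNReal.log (a i) := by
  classical
  induction s using Finset.induction_on with
  | empty => simp
  | insert i s hi ih => rw [Finset.prod_insert hi, Finset.sum_insert hi, ENNReal.log_mul_add, ih]

lemma log_pow_eq_nsmul (a : ℝ≥0∞) (n : ℕ) : ENNReal.log (a ^ n) = n • ENNReal.log a := by
  induction n with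
  | zero => simp
  | succ n ih => rw [pow_succ, ENNReal.log_mul_add, ih, succ_nsmul]

section ExpCusum

variable {𝒳 : Type*}

/-- The exponential of the CUSUM statistic with likelihood ratio `Λ`. -/
noncomputable def expCusum (Λ : 𝒳 → ℝ≥0∞) (x : ℕ → 𝒳) : ℕ → ℝ≥0∞
  | 0 => 1
  | t + 1 => max (expCusum Λ x t * Λ (x t)) 1

/-- The likelihood ratio of one observation. -/
noncomputable def likelihoodRatio (f g : 𝒳 → ℝ≥0) (x : 𝒳) : ℝ≥0∞ := (g x : ℝ≥0∞) / (f x : ℝ≥0∞)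

/-- The conventions agree at the extremes: 0 * ∞ = 0 in `ℝ≥0∞` matches -∞ + ∞ = -∞ in `EReal`.
Vanishing densities therefore need no separate treatment. -/
lemma cusum_eq_log_expCusum (f g : 𝒳 → ℝ≥0) (x : ℕ → 𝒳) (t : ℕ) :
    cusum f g x t = ENNReal.log (expCusum (likelihoodRatio f g) x t) := by
  induction t with
  | zero => simp [cusum, expCusum]
  | succ t ih =>
    rw [cusum, expCusum, ih, ENNReal.log_monotone.map_max, ENNReal.log_mul_add, ENNReal.log_one]
    rfl

variable (Λ : 𝒳 → ℝ≥0∞)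

lemma one_le_expCusum (x : ℕ → 𝒳) (t : ℕ) : 1 ≤ expCusum Λ x t := by
  cases t with
  | zero => exact le_rfl
  | succ t => exact le_max_right _ _

lemma expCusum_congr {x y : ℕ → 𝒳} {t : ℕ} (h : ∀ i < t, x i = y i) :
    expCusum Λ x t = expCusum Λ y t := by
  induction t with
  | zero => rfl
  | succ t ih => rw [expCusum, expCusum, ih fun i hi => h i (by omega), h t (by omega)]

/-- The statistic is at least 1 at time `a`, whatever happened before, and dropping the maximum
afterwards only decreases it. Block arguments can thus ignore the past. -/
lemma prod_le_expCusum (x : ℕ → 𝒳) (a m : ℕ) :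
    ∏ i ∈ Finset.range m, Λ (x (a + i)) ≤ expCusum Λ x (a + m) := by
  induction m with
  | zero => simpa using one_le_expCusum Λ x a
  | succ m ih =>
    rw [Finset.prod_range_succ, ← add_assoc, expCusum]
    exact (mul_le_mul_left ih _).trans (le_max_left _ _)

lemma expCusum_le_one {x : ℕ → 𝒳} (h : ∀ i, Λ (x i) ≤ 1) (t : ℕ) : expCusum Λ x t ≤ 1 := by
  induction t with
  | zero => exact le_rfl
  | succ t ih => exact max_le (mul_le_one' ih (h t)) le_rfl

lemma measurable_expCusum [MeasurableSpace 𝒳] {Λ : 𝒳 → ℝ≥0∞} (hΛ : Measurable Λ) (t : ℕ) :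
    Measurable fun x : ℕ → 𝒳 => expCusum Λ x t := by
  induction t with
  | zero => exact measurable_const
  | succ t ih => exact (ih.mul (hΛ.comp (measurable_pi_apply t))).max measurable_const

end ExpCusum

/-! ### Pathwise sufficient and necessary conditions for an alarm. -/

section LowSumCusum

variable {𝒳 : Type*} {ι : Type*} [Fintype ι] {f g : 𝒳 → ℝ≥0} {L : ℕ} {h : ℝ}

lemma lowSumCusum_le_iff (x : ℕ → ι → 𝒳) (m : ℕ) :
    lowSumCusum f g L h x ≤ m ↔ ∃ t, 1 ≤ t ∧ t ≤ m ∧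
      (h : EReal) ≤ sumSmallest L fun k => cusum f g (fun s => x s k) t := by
  constructor
  · intro hm
    have hlt : lowSumCusum f g L h x < ((m + 1 : ℕ) : ℕ∞) :=
      hm.trans_lt (by exact_mod_cast Nat.lt_succ_self m)
    simp only [lowSumCusum, iInf_lt_iff] at hlt
    obtain ⟨t, ht, htm⟩ := hlt
    exact ⟨t, ht.1, Nat.lt_succ_iff.1 (by exact_mod_cast htm), ht.2⟩
  · rintro ⟨t, ht1, htm, ht⟩
    exact (iInf₂_le t ⟨ht1, ht⟩).trans (by exact_mod_cast htm)

lemma one_le_lowSumCusum (x : ℕ → ι → 𝒳) : 1 ≤ lowSumCusum f g L h x :=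
  le_iInf₂ fun t ht => by exact_mod_cast ht.1

lemma lowSumCusum_comp_le {κ : Type*} [Fintype κ] (hL : L ≤ Fintype.card κ) {e : κ → ι}
    (he : Function.Injective e) (x : ℕ → ι → 𝒳) :
    lowSumCusum f g L h (fun t k => x t (e k)) ≤ lowSumCusum f g L h x :=
  le_iInf₂ fun t ht => iInf₂_le t ⟨ht.1, ht.2.trans (sumSmallest_le_sumSmallest_comp hL he _)⟩

/-- Used with `s` all honest sensors and c = h/L for the false alarm time, and with `s` the affected
sensors and c = h/r for the delay. -/
lemma lowSumCusum_le_of_expCusum (hL : L ≤ Fintype.card ι) {s : Finset ι} {c : ℝ} (hc : 0 ≤ c)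
    (hh : h = (L + s.card - Fintype.card ι : ℕ) * c) {x : ℕ → ι → 𝒳} {t : ℕ} (ht : 1 ≤ t)
    (hx : ∀ k ∈ s, ENNReal.ofReal (Real.exp c) ≤
      expCusum (likelihoodRatio f g) (fun i => x i k) t) :
    lowSumCusum f g L h x ≤ t := by
  rw [lowSumCusum_le_iff]
  refine ⟨t, ht, le_rfl, ?_⟩
  have h1 := nsmul_le_sumSmallest hL (y := fun k => cusum f g (fun s => x s k) t)
    (fun k => by
      rw [cusum_eq_log_expCusum, ENNReal.zero_le_log_iff]
      exact one_le_expCusum _ _ _) (s := s) (c := (c : EReal)) (by exact_mod_cast hc)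
    (fun k hk => by
      rw [cusum_eq_log_expCusum, ← EReal.log_exp (c : EReal), EReal.exp_coe]
      exact ENNReal.log_monotone (hx k hk))
  refine le_trans (le_of_eq ?_) h1
  rw [hh, EReal.nsmul_eq_mul]
  push_cast
  rfl

lemma exists_le_prod_of_lowSumCusum_le {x : ℕ → ι → 𝒳} {m : ℕ}
    (hm : lowSumCusum f g L h x ≤ m) {s : Finset ι} (hs : s.card = L) :
    ∃ t ≤ m, ENNReal.ofReal (Real.exp h) ≤
      ∏ k ∈ s, expCusum (likelihoodRatio f g) (fun i => x i k) t := by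
  obtain ⟨t, -, htm, ht⟩ := (lowSumCusum_le_iff x m).1 hm
  refine ⟨t, htm, ?_⟩
  rw [← ENNReal.log_le_log_iff, log_finset_prod, ← EReal.exp_coe, EReal.log_exp]
  refine (ht.trans (sumSmallest_le_sum _ hs)).trans (le_of_eq ?_)
  exact Finset.sum_congr rfl fun k _ => cusum_eq_log_expCusum _ _ _ _

lemma exists_le_prod_univ_of_lowSumCusum_le (hL1 : 1 ≤ L) (hL : L ≤ Fintype.card ι)
    {x : ℕ → ι → 𝒳} {m : ℕ} (hm : lowSumCusum f g L h x ≤ m) :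
    ∃ t ≤ m, ENNReal.ofReal (Real.exp (Fintype.card ι / L * h)) ≤
      ∏ k, expCusum (likelihoodRatio f g) (fun i => x i k) t := by
  obtain ⟨t, -, htm, ht⟩ := (lowSumCusum_le_iff x m).1 hm
  refine ⟨t, htm, ?_⟩
  have hL0 : (L : ℝ) ≠ 0 := by positivity
  have h1 := (nsmul_le_nsmul_right ht (Fintype.card ι)).trans
    (card_nsmul_sumSmallest_le hL fun k => cusum f g (fun s => x s k) t)
  simp only [cusum_eq_log_expCusum] at h1
  rw [← log_finset_prod, ← log_pow_eq_nsmul] at h1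
  have h2 : Fintype.card ι • (h : EReal) = (((Fintype.card ι : ℝ) * h : ℝ) : EReal) := by
    rw [EReal.nsmul_eq_mul]; push_cast; rfl
  rw [h2, ← EReal.log_exp ((((Fintype.card ι : ℝ) * h : ℝ)) : EReal), ENNReal.log_le_log_iff,
    EReal.exp_coe] at h1
  rw [← ENNReal.pow_le_pow_left_iff (n := L) (by omega)]
  refine le_trans (le_of_eq ?_) h1
  rw [← ENNReal.ofReal_pow (Real.exp_pos _).le, ← Real.exp_nat_mul]
  congr 2
  field_simp

end LowSumCusum

/-! ### Independence of functions of disjoint sets of coordinates. -/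

section Independence

open ProbabilityTheory

lemma indepFun_of_dependsOn {ι E β γ : Type*} [MeasurableSpace E] [MeasurableSpace β]
    [MeasurableSpace γ] [Nonempty E] (μ : ι → Measure E) [∀ i, IsProbabilityMeasure (μ i)]
    {S T : Finset ι} (hST : Disjoint S T) {φ : (ι → E) → β} {ψ : (ι → E) → γ}
    (hφ : Measurable φ) (hψ : Measurable ψ) (hφS : DependsOn φ (S : Set ι))
    (hψT : DependsOn ψ (T : Set ι)) : IndepFun φ ψ (Measure.infinitePi μ) := by
  classical
  obtain ⟨e⟩ := ‹Nonempty E›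
  -- Filling the missing coordinates with a fixed point writes `φ` and `ψ` as functions of finite
  -- restrictions.
  let ext (S : Finset ι) (y : S → E) (i : ι) : E := if h : i ∈ S then y ⟨i, h⟩ else e
  have hext (S : Finset ι) : Measurable (ext S) := by
    refine measurable_pi_lambda _ fun i => ?_
    by_cases h : i ∈ S
    · simpa only [ext, h, dite_true] using measurable_pi_apply _
    · simpa only [ext, h, dite_false] using measurable_const
  have key := ((iIndepFun_infinitePi (P := μ) (X := fun _ ω => ω)
    fun _ => measurable_id).indepFun_finset S T hST (by fun_prop)).comp
    (hφ.comp (hext S)) (hψ.comp (hext T))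
  convert key using 1
  · exact funext fun ω => hφS fun i hi => by simp [ext, Finset.mem_coe.1 hi]
  · exact funext fun ω => hψT fun i hi => by simp [ext, Finset.mem_coe.1 hi]

end Independence

/-- `Λ` is the likelihood ratio of `P₁` with respect to `P₀ ≠ P₁`, and `I` is the
Kullback-Leibler information number of `P₁` with respect to `P₀`. -/
structure IsLikelihoodRatio {𝒳 : Type*} [MeasurableSpace 𝒳] (P₀ P₁ : Measure 𝒳)
    (Λ : 𝒳 → ℝ≥0∞) (I : ℝ) : Prop where
  measurable : Measurable Λ
  withDensity_eq : P₀.withDensity Λ = P₁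
  frequently_ne_one : ∃ᵐ x ∂P₀, Λ x ≠ 1
  integrable : Integrable (fun x => Real.log (Λ x).toReal) P₁
  integral_eq : ∫ x, Real.log (Λ x).toReal ∂P₁ = I
  pos : 0 < I

/-! ### The likelihood ratio of the two densities. -/

section Densities

variable {𝒳 : Type*} [MeasurableSpace 𝒳] {lam : Measure 𝒳} {f g : 𝒳 → ℝ≥0}

lemma isProbabilityMeasure_densityMeasure (hf : ∫⁻ x, (f x : ℝ≥0∞) ∂lam = 1) :
    IsProbabilityMeasure (densityMeasure lam f) :=
  ⟨by rw [densityMeasure, withDensity_apply _ .univ, setLIntegral_univ, hf]⟩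

lemma isLikelihoodRatio_densityMeasure (hf : Measurable f) (hg : Measurable g)
    (hf_int : ∫⁻ x, (f x : ℝ≥0∞) ∂lam = 1) (hg_int : ∫⁻ x, (g x : ℝ≥0∞) ∂lam = 1)
    (hI_pos : 0 < klNumber lam f g) (hI_fin : klNumber lam f g < ⊤) :
    IsLikelihoodRatio (densityMeasure lam f) (densityMeasure lam g) (likelihoodRatio f g)
      (klNumber lam f g).toReal := by
  have := isProbabilityMeasure_densityMeasure hf_int
  have := isProbabilityMeasure_densityMeasure hg_int
  obtain ⟨hac, hint⟩ := InformationTheory.klDiv_ne_top_iff.1 hI_fin.ne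
  have hΛ : Measurable (likelihoodRatio f g) := hg.coe_nnreal_ennreal.div hf.coe_nnreal_ennreal
  have hzero : ∀ᵐ x ∂lam, f x = 0 → g x = 0 := by
    have h0 : densityMeasure lam f {x | f x = 0} = 0 := by
      rw [densityMeasure, withDensity_apply_eq_zero hf.coe_nnreal_ennreal]
      simp [Set.inter_def]
    have h1 := hac h0
    rw [densityMeasure, withDensity_apply_eq_zero hg.coe_nnreal_ennreal] at h1
    filter_upwards [measure_eq_zero_iff_ae_notMem.1 h1] with x hx hfx
    by_contra hgx
    exact hx ⟨by simpa using hgx, hfx⟩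
  have hwd : (densityMeasure lam f).withDensity (likelihoodRatio f g) = densityMeasure lam g := by
    rw [densityMeasure, ← withDensity_mul _ hf.coe_nnreal_ennreal hΛ]
    refine withDensity_congr_ae ?_
    filter_upwards [hzero] with x hx
    by_cases hfx : f x = 0
    · simp [likelihoodRatio, hfx, hx hfx]
    · exact ENNReal.mul_div_cancel (by simpa using hfx) ENNReal.coe_ne_top
  have hllr : (fun x => Real.log (likelihoodRatio f g x).toReal)
      =ᵐ[densityMeasure lam g] llr (densityMeasure lam g) (densityMeasure lam f) := by
    have h1 := Measure.rnDeriv_withDensity (densityMeasure lam f) hΛ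
    rw [hwd] at h1
    filter_upwards [hac.ae_le h1] with x hx
    rw [llr, hx]
  refine ⟨hΛ, hwd, ?_, hint.congr hllr.symm, ?_, ENNReal.toReal_pos hI_pos.ne' hI_fin.ne⟩
  · intro hone
    refine hI_pos.ne' (InformationTheory.klDiv_eq_zero_iff.2 ?_)
    rw [← hwd]
    nth_rewrite 2 [← withDensity_one (μ := densityMeasure lam f)]
    refine withDensity_congr_ae ?_
    filter_upwards [hone] with x hx
    simpa using hx
  · rw [integral_congr_ae hllr, klNumber,
      InformationTheory.toReal_klDiv_of_measure_eq hac (by simp)]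

/-- Otherwise f < g everywhere, although both integrate to 1. Such a point is what the adversary
plays in the lower bound for the delay. -/
lemma exists_likelihoodRatio_le_one (hg : Measurable g)
    (hf_int : ∫⁻ x, (f x : ℝ≥0∞) ∂lam = 1) (hg_int : ∫⁻ x, (g x : ℝ≥0∞) ∂lam = 1) :
    ∃ x, likelihoodRatio f g x ≤ 1 := by
  by_contra! hcon
  have hlt : ∀ x, (f x : ℝ≥0∞) < g x := fun x => by
    by_contra! hle
    exact (hcon x).not_ge (ENNReal.div_le_of_le_mul (by simpa using hle))
  have hlam : lam ≠ 0 := by rintro rfl; simp at hf_int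
  have := lintegral_strict_mono hlam hg.coe_nnreal_ennreal.aemeasurable (by simp [hf_int])
    (ae_of_all _ hlt)
  simp [hf_int, hg_int] at this

end Densities

/-! ### Moments of order below one under no change. -/

namespace IsLikelihoodRatio

variable {𝒳 : Type*} [MeasurableSpace 𝒳] {P₀ P₁ : Measure 𝒳} [IsProbabilityMeasure P₀]
  [IsProbabilityMeasure P₁] {Λ : 𝒳 → ℝ≥0∞} {I : ℝ}

omit [IsProbabilityMeasure P₀] in
lemma lintegral_eq_one (H : IsLikelihoodRatio P₀ P₁ Λ I) : ∫⁻ x, Λ x ∂P₀ = 1 := by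
  rw [← setLIntegral_univ, ← withDensity_apply _ .univ, H.withDensity_eq, measure_univ]

omit [IsProbabilityMeasure P₀] in
lemma ae_ne_zero_ne_top (H : IsLikelihoodRatio P₀ P₁ Λ I) : ∀ᵐ x ∂P₁, Λ x ≠ 0 ∧ Λ x ≠ ⊤ := by
  rw [← H.withDensity_eq, ae_withDensity_iff H.measurable]
  filter_upwards [ae_lt_top H.measurable (by simp [H.lintegral_eq_one])] with x hx h0
  exact ⟨h0, hx.ne⟩

/-- Bernoulli's inequality λ ^ θ ≤ 1 + θ (λ - 1) is strict unless λ = 1, the right side integrates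
to 1, and Λ ≠ 1 with positive probability. -/
lemma lintegral_rpow_lt_one (H : IsLikelihoodRatio P₀ P₁ Λ I) {θ : ℝ} (hθ0 : 0 < θ)
    (hθ1 : θ < 1) : ∫⁻ x, Λ x ^ θ ∂P₀ < 1 := by
  have hfin := ae_lt_top H.measurable (μ := P₀) (by simp [H.lintegral_eq_one])
  have hreal : ∀ x, Λ x < ⊤ → Λ x ^ θ = ENNReal.ofReal ((1 + ((Λ x).toReal - 1)) ^ θ) ∧
      ENNReal.ofReal θ * Λ x + ENNReal.ofReal (1 - θ) =
        ENNReal.ofReal (1 + θ * ((Λ x).toReal - 1)) := by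
    intro x hx
    have h0 : 0 ≤ (Λ x).toReal := ENNReal.toReal_nonneg
    constructor
    · rw [add_sub_cancel, ← ENNReal.ofReal_rpow_of_nonneg h0 hθ0.le, ENNReal.ofReal_toReal hx.ne]
    · nth_rewrite 1 [← ENNReal.ofReal_toReal hx.ne]
      rw [← ENNReal.ofReal_mul hθ0.le, ← ENNReal.ofReal_add (by positivity) (by linarith)]
      congr 1
      ring
  have hle : ∀ᵐ x ∂P₀, Λ x ^ θ ≤ ENNReal.ofReal θ * Λ x + ENNReal.ofReal (1 - θ) := by
    filter_upwards [hfin] with x hx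
    rw [(hreal x hx).1, (hreal x hx).2]
    exact ENNReal.ofReal_le_ofReal (rpow_one_add_le_one_add_mul_self
      (by linarith [(ENNReal.toReal_nonneg : 0 ≤ (Λ x).toReal)]) hθ0.le hθ1.le)
  have hint : ∫⁻ x, (ENNReal.ofReal θ * Λ x + ENNReal.ofReal (1 - θ)) ∂P₀ = 1 := by
    rw [lintegral_add_right _ measurable_const, lintegral_const_mul _ H.measurable,
      H.lintegral_eq_one, lintegral_const, measure_univ, mul_one, mul_one,
      ← ENNReal.ofReal_add hθ0.le (by linarith)]
    simp
  rw [← hint]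
  refine lintegral_strict_mono_of_ae_le_of_frequently_ae_lt
    ((H.measurable.const_mul _).add measurable_const).aemeasurable
    (ne_top_of_le_ne_top (by simp [hint]) (lintegral_mono_ae hle)) hle ?_
  refine (H.frequently_ne_one.and_eventually hfin).mono fun x hx => ne_of_lt ?_
  rw [(hreal x hx.2).1, (hreal x hx.2).2]
  have h1 : (Λ x).toReal - 1 ≠ 0 := fun h => hx.1 (by
    rw [← ENNReal.ofReal_toReal hx.2.ne, sub_eq_zero.1 h, ENNReal.ofReal_one])
  have h2 : -1 ≤ (Λ x).toReal - 1 := by linarith [(ENNReal.toReal_nonneg : 0 ≤ (Λ x).toReal)]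
  have h3 := rpow_one_add_lt_one_add_mul_self h2 h1 hθ0 hθ1
  exact (ENNReal.ofReal_lt_ofReal_iff_of_nonneg (Real.rpow_nonneg (by linarith) _)).2 h3

/-- Since max(u, 1) ^ θ ≤ u ^ θ + 1, independence turns the CUSUM recursion into e(t+1) ≤ ρ e(t) + 1
with ρ < 1; the fixed point bounds all moments uniformly in time. At θ = 1 one would have ρ = 1,
hence the restriction to θ < 1. -/
lemma lintegral_expCusum_rpow_le (H : IsLikelihoodRatio P₀ P₁ Λ I) {θ : ℝ} (hθ0 : 0 < θ)
    (hθ1 : θ < 1) (t : ℕ) :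
    ∫⁻ x, expCusum Λ x t ^ θ ∂(Measure.infinitePi fun _ : ℕ => P₀) ≤
      (1 - ∫⁻ x, Λ x ^ θ ∂P₀)⁻¹ := by
  have : Nonempty 𝒳 := nonempty_of_isProbabilityMeasure P₀
  have hρ := H.lintegral_rpow_lt_one hθ0 hθ1
  set ρ := ∫⁻ x, Λ x ^ θ ∂P₀ with hρdef
  have hne : 1 - ρ ≠ 0 := (tsub_pos_of_lt hρ).ne'
  have hnt : 1 - ρ ≠ ⊤ := ne_top_of_le_ne_top ENNReal.one_ne_top tsub_le_self
  have hfix : (1 - ρ)⁻¹ * ρ + 1 = (1 - ρ)⁻¹ := by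
    calc (1 - ρ)⁻¹ * ρ + 1 = (1 - ρ)⁻¹ * ρ + (1 - ρ)⁻¹ * (1 - ρ) := by
          rw [ENNReal.inv_mul_cancel hne hnt]
      _ = (1 - ρ)⁻¹ := by rw [← mul_add, add_tsub_cancel_of_le hρ.le, mul_one]
  have hΛθ : Measurable fun x => Λ x ^ θ := H.measurable.pow_const θ
  induction t with
  | zero =>
    simp only [expCusum, ENNReal.one_rpow, lintegral_const, measure_univ, mul_one]
    exact ENNReal.one_le_inv.2 tsub_le_self
  | succ t ih =>
    have hmeas := (measurable_expCusum H.measurable t).pow_const θ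
    have hΛt : Measurable fun x : ℕ → 𝒳 => Λ (x t) ^ θ := hΛθ.comp (measurable_pi_apply t)
    have hind := indepFun_of_dependsOn (fun _ : ℕ => P₀) (S := Finset.range t) (T := {t})
      (by simp) hmeas hΛt
      (fun x y hxy => by rw [expCusum_congr Λ fun i hi => hxy i (by simpa using hi)])
      (fun x y hxy => by rw [hxy t (by simp)])
    calc ∫⁻ x, expCusum Λ x (t + 1) ^ θ ∂(Measure.infinitePi fun _ : ℕ => P₀)
        ≤ ∫⁻ x, (expCusum Λ x t ^ θ * Λ (x t) ^ θ + 1)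
            ∂(Measure.infinitePi fun _ : ℕ => P₀) := by
          refine lintegral_mono fun x => ?_
          rw [expCusum, (ENNReal.monotone_rpow_of_nonneg hθ0.le).map_max, ENNReal.one_rpow,
            ENNReal.mul_rpow_of_nonneg _ _ hθ0.le]
          exact max_le le_self_add le_add_self
      _ = (∫⁻ x, expCusum Λ x t ^ θ ∂(Measure.infinitePi fun _ : ℕ => P₀)) * ρ + 1 := by
          rw [lintegral_add_right _ measurable_const, lintegral_const, measure_univ, mul_one]
          congr 1
          have h1 := ProbabilityTheory.lintegral_mul_eq_lintegral_mul_lintegral_of_indepFun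
            hmeas hΛt hind
          simp only [Pi.mul_apply] at h1
          rw [h1, hρdef]
          congr 1
          have h2 : (Measure.infinitePi fun _ : ℕ => P₀).map (fun x => x t) = P₀ :=
            Measure.infinitePi_map_eval _ t
          nth_rewrite 2 [← h2]
          rw [lintegral_map hΛθ (measurable_pi_apply t)]
      _ ≤ (1 - ρ)⁻¹ * ρ + 1 := by gcongr
      _ = _ := hfix

end IsLikelihoodRatio

lemma pi_withDensity_prod {ι 𝒳 : Type*} [Fintype ι] [MeasurableSpace 𝒳] (P : Measure 𝒳)
    [IsProbabilityMeasure P] {Λ : 𝒳 → ℝ≥0∞} (hΛ : Measurable Λ)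
    [IsProbabilityMeasure (P.withDensity Λ)] :
    Measure.pi (fun _ : ι => P.withDensity Λ) =
      (Measure.pi fun _ : ι => P).withDensity fun y => ∏ i, Λ (y i) := by
  refine Measure.pi_eq fun s hs => ?_
  have hbox : (Set.univ.pi s).indicator (fun y : ι → 𝒳 => ∏ i, Λ (y i)) =
      fun y => ∏ i, (s i).indicator Λ (y i) := by
    ext y
    by_cases hy : y ∈ Set.univ.pi s
    · rw [Set.indicator_of_mem hy]
      exact Finset.prod_congr rfl fun i _ => (Set.indicator_of_mem (hy i trivial) _).symm
    · rw [Set.indicator_of_notMem hy]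
      obtain ⟨i, hi⟩ : ∃ i, y i ∉ s i := by simpa [Set.mem_pi] using hy
      exact (Finset.prod_eq_zero (Finset.mem_univ i) (Set.indicator_of_notMem hi _)).symm
  have hmeas : ∀ i, Measurable ((s i).indicator Λ) := fun i => hΛ.indicator (hs i)
  have hind := ProbabilityTheory.iIndepFun_infinitePi (P := fun _ : ι => P)
    (X := fun i ω => (s i).indicator Λ ω) hmeas
  rw [Measure.infinitePi_eq_pi] at hind
  rw [withDensity_apply _ (MeasurableSet.univ_pi hs), ← lintegral_indicator (.univ_pi hs), hbox,
    ProbabilityTheory.lintegral_prod_eq_prod_lintegral_of_indepFun _ _ hind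
      fun i => (hmeas i).comp (measurable_pi_apply i)]
  refine Finset.prod_congr rfl fun i _ => ?_
  have h2 : (Measure.pi fun _ : ι => P).map (fun x => x i) = P := by
    rw [← Measure.infinitePi_eq_pi]; exact Measure.infinitePi_map_eval _ i
  rw [withDensity_apply _ (hs i), ← lintegral_indicator (hs i)]
  nth_rewrite 2 [← h2]
  rw [lintegral_map (hmeas i) (measurable_pi_apply i)]

/-! ### Pathwise consequences of linear growth of the log-likelihood. -/

section Deterministic

variable {𝒳 : Type*} {Λ : 𝒳 → ℝ≥0∞} {x : ℕ → 𝒳}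

/-- The CUSUM statistic is the random walk minus its running minimum, so a walk bounded below by -C
differs from it by at most C. -/
lemma expCusum_le_of_sum_ge {z : ℕ → ℝ} (hz : ∀ i, Λ (x i) = ENNReal.ofReal (Real.exp (z i)))
    {C : ℝ} (hC : ∀ t, -C ≤ ∑ i ∈ Finset.range t, z i) (t : ℕ) :
    expCusum Λ x t ≤ ENNReal.ofReal (Real.exp (∑ i ∈ Finset.range t, z i + C)) := by
  have hone : ∀ t, 1 ≤ ENNReal.ofReal (Real.exp (∑ i ∈ Finset.range t, z i + C)) := fun t => by
    rw [ENNReal.one_le_ofReal]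
    exact Real.one_le_exp (by linarith [hC t])
  induction t with
  | zero => exact hone 0
  | succ t ih =>
    refine max_le ?_ (hone _)
    calc _ ≤ ENNReal.ofReal (Real.exp (∑ i ∈ Finset.range t, z i + C)) * Λ (x t) := by gcongr
      _ = _ := by
        rw [hz, ← ENNReal.ofReal_mul (Real.exp_pos _).le, ← Real.exp_add, Finset.sum_range_succ]
        congr 2
        ring

lemma prod_eq_ofReal_exp_sum {z : ℕ → ℝ}
    (hz : ∀ i, Λ (x i) = ENNReal.ofReal (Real.exp (z i))) (m : ℕ) :
    ∏ i ∈ Finset.range m, Λ (x i) =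
      ENNReal.ofReal (Real.exp (∑ i ∈ Finset.range m, z i)) := by
  rw [Real.exp_sum, ENNReal.ofReal_prod_of_nonneg fun i _ => (Real.exp_pos _).le]
  exact Finset.prod_congr rfl fun i _ => hz i

variable {S : ℕ → ℝ} {I : ℝ}

lemma tendsto_sub_mul_of_tendsto_div (hS : Tendsto (fun n : ℕ => S n / n) atTop (𝓝 I)) (c : ℝ) :
    Tendsto (fun n : ℕ => (S n - c * n) / n) atTop (𝓝 (I - c)) := by
  refine (hS.sub_const c).congr' ?_
  filter_upwards [eventually_ge_atTop 1] with n hn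
  have : (n : ℝ) ≠ 0 := by positivity
  field_simp

lemma tendsto_atTop_of_tendsto_div (hS : Tendsto (fun n : ℕ => S n / n) atTop (𝓝 I))
    (hI : 0 < I) : Tendsto S atTop atTop := by
  refine (hS.pos_mul_atTop hI tendsto_natCast_atTop_atTop).congr' ?_
  filter_upwards [eventually_ge_atTop 1] with n hn
  have : (n : ℝ) ≠ 0 := by positivity
  field_simp

lemma exists_le_of_tendsto_atTop (hS : Tendsto S atTop atTop) : ∃ C, ∀ t, -C ≤ S t := by
  obtain ⟨b, hb⟩ := bddBelow_range_of_tendsto_atTop_atTop hS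
  exact ⟨-b, fun t => by simpa using hb ⟨t, rfl⟩⟩

lemma eventually_expCusum_le {z : ℕ → ℝ}
    (hz : ∀ i, Λ (x i) = ENNReal.ofReal (Real.exp (z i)))
    (hS : Tendsto (fun n : ℕ => (∑ i ∈ Finset.range n, z i) / n) atTop (𝓝 I)) (hI : 0 < I)
    {δ : ℝ} (hδ : 0 < δ) :
    ∀ᶠ m : ℕ in atTop, ∀ t ≤ m,
      expCusum Λ x t ≤ ENNReal.ofReal (Real.exp (m * (I * (1 + δ)))) := by
  obtain ⟨C, hC⟩ := exists_le_of_tendsto_atTop (tendsto_atTop_of_tendsto_div hS hI)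
  -- Half of the slack δ makes the walk stay below the line of slope I(1 + δ/2) up to a constant
  -- `D`, for all times at once. The other half absorbs `C + D` once `m` is large.
  have h1 : Tendsto (fun n : ℕ => -((∑ i ∈ Finset.range n, z i) - I * (1 + δ / 2) * n))
      atTop atTop := by
    refine tendsto_atTop_of_tendsto_div (I := I * (δ / 2)) ?_ (by positivity)
    have := (tendsto_sub_mul_of_tendsto_div hS (I * (1 + δ / 2))).neg
    convert this using 2
    · ring
    · ring
  obtain ⟨D, hD⟩ := exists_le_of_tendsto_atTop h1
  have h2 : Tendsto (fun m : ℕ => (m : ℝ) * (I * (δ / 2))) atTop atTop :=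
    tendsto_natCast_atTop_atTop.atTop_mul_const (by positivity)
  filter_upwards [h2.eventually_ge_atTop (C + D)] with m hm t ht
  refine (expCusum_le_of_sum_ge hz hC t).trans ?_
  refine ENNReal.ofReal_le_ofReal (Real.exp_le_exp.2 ?_)
  have h3 : I * (1 + δ / 2) * t ≤ I * (1 + δ / 2) * m := by gcongr
  nlinarith [hD t]

lemma eventually_le_prod {z : ℕ → ℝ}
    (hz : ∀ i, Λ (x i) = ENNReal.ofReal (Real.exp (z i)))
    (hS : Tendsto (fun n : ℕ => (∑ i ∈ Finset.range n, z i) / n) atTop (𝓝 I)) (hI : 0 < I)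
    {δ : ℝ} (hδ : 0 < δ) :
    ∀ᶠ m : ℕ in atTop,
      ENNReal.ofReal (Real.exp (m * (I * (1 - δ)))) ≤ ∏ i ∈ Finset.range m, Λ (x i) := by
  have h1 := (tendsto_sub_mul_of_tendsto_div hS (I * (1 - δ)))
  have h2 := tendsto_atTop_of_tendsto_div h1 (by nlinarith)
  filter_upwards [h2.eventually_ge_atTop 0] with m hm
  rw [prod_eq_ofReal_exp_sum hz]
  exact ENNReal.ofReal_le_ofReal (Real.exp_le_exp.2 (by linarith))

end Deterministic

lemma measurableSet_forall_expCusum_le {𝒳 : Type*} [MeasurableSpace 𝒳] {Λ : 𝒳 → ℝ≥0∞}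
    (hΛ : Measurable Λ) (m : ℕ) (c : ℝ≥0∞) :
    MeasurableSet {x : ℕ → 𝒳 | ∀ t ≤ m, expCusum Λ x t ≤ c} := by
  simp only [Set.ofPred_forall]
  exact .iInter fun t => .iInter fun _ =>
    measurableSet_le (measurable_expCusum hΛ t) measurable_const

lemma measurableSet_le_prod {𝒳 : Type*} [MeasurableSpace 𝒳] {Λ : 𝒳 → ℝ≥0∞}
    (hΛ : Measurable Λ) (m : ℕ) (c : ℝ≥0∞) :
    MeasurableSet {x : ℕ → 𝒳 | c ≤ ∏ i ∈ Finset.range m, Λ (x i)} :=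
  measurableSet_le measurable_const
    (Finset.measurable_prod _ fun i _ => hΛ.comp (measurable_pi_apply i))

/-! ### Law of large numbers and change of measure. -/

namespace IsLikelihoodRatio

variable {𝒳 : Type*} [MeasurableSpace 𝒳] {P₀ P₁ : Measure 𝒳} [IsProbabilityMeasure P₀]
  [IsProbabilityMeasure P₁] {Λ : 𝒳 → ℝ≥0∞} {I : ℝ}

omit [IsProbabilityMeasure P₀] in
lemma ae_tendsto_sum_div (H : IsLikelihoodRatio P₀ P₁ Λ I) :
    ∀ᵐ x ∂(Measure.infinitePi fun _ : ℕ => P₁),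
      (∀ i, Λ (x i) = ENNReal.ofReal (Real.exp (Real.log (Λ (x i)).toReal))) ∧
      Tendsto (fun n : ℕ => (∑ i ∈ Finset.range n, Real.log (Λ (x i)).toReal) / n) atTop
        (𝓝 I) := by
  have hmap : ∀ i, (Measure.infinitePi fun _ : ℕ => P₁).map (fun x => x i) = P₁ := fun i =>
    Measure.infinitePi_map_eval _ i
  have hmeas : Measurable fun x => Real.log (Λ x).toReal :=
    Real.measurable_log.comp H.measurable.ennreal_toReal
  have h1 : ∀ i, ∀ᵐ x ∂(Measure.infinitePi fun _ : ℕ => P₁), Λ (x i) ≠ 0 ∧ Λ (x i) ≠ ⊤ := by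
    intro i
    have := H.ae_ne_zero_ne_top
    rw [← hmap i] at this
    exact ae_of_ae_map (measurable_pi_apply i).aemeasurable this
  have hind := ProbabilityTheory.iIndepFun_infinitePi (P := fun _ : ℕ => P₁)
    (X := fun _ ω => Real.log (Λ ω).toReal) fun _ => hmeas
  have h2 := ProbabilityTheory.strong_law_ae_real
    (μ := Measure.infinitePi fun _ : ℕ => P₁) (fun i x => Real.log (Λ (x i)).toReal)
    (by
      have := H.integrable
      rw [← hmap 0] at this
      exact this.comp_measurable (measurable_pi_apply 0))
    (fun i j hij => hind.indepFun hij)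
    (fun i => ⟨(hmeas.comp (measurable_pi_apply i)).aemeasurable,
      (hmeas.comp (measurable_pi_apply 0)).aemeasurable, by
        have h3 : ∀ i, (Measure.infinitePi fun _ : ℕ => P₁).map
            (fun x => Real.log (Λ (x i)).toReal) =
              P₁.map fun x => Real.log (Λ x).toReal := fun i => by
          nth_rewrite 2 [← hmap i]
          rw [Measure.map_map hmeas (measurable_pi_apply i)]
          rfl
        rw [h3, h3]⟩)
  have h4 : ∫ x, Real.log (Λ (x 0)).toReal ∂(Measure.infinitePi fun _ : ℕ => P₁) = I := by
    rw [← H.integral_eq]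
    nth_rewrite 2 [← hmap 0]
    rw [integral_map (measurable_pi_apply 0).aemeasurable hmeas.aestronglyMeasurable]
  rw [h4] at h2
  filter_upwards [h2, ae_all_iff.2 h1] with x hx hx1
  refine ⟨fun i => ?_, hx⟩
  rw [Real.exp_log (ENNReal.toReal_pos (hx1 i).1 (hx1 i).2), ENNReal.ofReal_toReal (hx1 i).2]

omit [IsProbabilityMeasure P₀] in
lemma tendsto_measure_expCusum_le (H : IsLikelihoodRatio P₀ P₁ Λ I) {δ : ℝ} (hδ : 0 < δ) :
    Tendsto (fun m : ℕ => Measure.infinitePi (fun _ : ℕ => P₁)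
      {x | ∀ t ≤ m, expCusum Λ x t ≤ ENNReal.ofReal (Real.exp (m * (I * (1 + δ))))})
      atTop (𝓝 1) := by
  rw [← measure_univ (μ := Measure.infinitePi fun _ : ℕ => P₁)]
  refine tendsto_measure_of_ae_tendsto_indicator_of_isFiniteMeasure _ .univ
    (fun m => measurableSet_forall_expCusum_le H.measurable _ _) ?_
  filter_upwards [H.ae_tendsto_sum_div] with x hx
  simpa using eventually_expCusum_le hx.1 hx.2 H.pos hδ

omit [IsProbabilityMeasure P₀] in
lemma tendsto_measure_le_prod (H : IsLikelihoodRatio P₀ P₁ Λ I) {δ : ℝ} (hδ : 0 < δ) :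
    Tendsto (fun m : ℕ => Measure.infinitePi (fun _ : ℕ => P₁)
      {x | ENNReal.ofReal (Real.exp (m * (I * (1 - δ)))) ≤ ∏ i ∈ Finset.range m, Λ (x i)})
      atTop (𝓝 1) := by
  rw [← measure_univ (μ := Measure.infinitePi fun _ : ℕ => P₁)]
  refine tendsto_measure_of_ae_tendsto_indicator_of_isFiniteMeasure _ .univ
    (fun m => measurableSet_le_prod H.measurable _ _) ?_
  filter_upwards [H.ae_tendsto_sum_div] with x hx
  simpa using eventually_le_prod hx.1 hx.2 H.pos hδ

/-- On the first `m` observations the density of the `P₁` law with respect to the `P₀` law is the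
product itself, which is at most `C` on the event. -/
lemma measure_prod_mem_Icc_le (H : IsLikelihoodRatio P₀ P₁ Λ I) (m : ℕ) (c C : ℝ≥0∞) :
    Measure.infinitePi (fun _ : ℕ => P₁)
        {x | c ≤ ∏ i ∈ Finset.range m, Λ (x i) ∧ ∏ i ∈ Finset.range m, Λ (x i) ≤ C} ≤
      C * Measure.infinitePi (fun _ : ℕ => P₀) {x | c ≤ ∏ i ∈ Finset.range m, Λ (x i)} := by
  have hres : ∀ (P : Measure 𝒳) [IsProbabilityMeasure P],
      (Measure.infinitePi fun _ : ℕ => P).map (fun x (i : Fin m) => x i) =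
        Measure.pi fun _ => P := fun P _ => by
    rw [Measure.map_infinitePi_infinitePi_of_inj Fin.val_injective, Measure.infinitePi_eq_pi]
  have hφ : Measurable fun (x : ℕ → 𝒳) (i : Fin m) => x i := by fun_prop
  have hprod : Measurable fun y : Fin m → 𝒳 => ∏ i, Λ (y i) :=
    Finset.measurable_prod _ fun i _ => H.measurable.comp (measurable_pi_apply i)
  have hA : MeasurableSet {y : Fin m → 𝒳 | c ≤ ∏ i, Λ (y i) ∧ ∏ i, Λ (y i) ≤ C} :=
    (measurableSet_le measurable_const hprod).inter (measurableSet_le hprod measurable_const)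
  have hpre : ∀ x : ℕ → 𝒳, ∏ i ∈ Finset.range m, Λ (x i) = ∏ i : Fin m, Λ (x i) := fun x =>
    Finset.prod_range _
  have : IsProbabilityMeasure (P₀.withDensity Λ) := H.withDensity_eq ▸ inferInstance
  have hpi : Measure.pi (fun _ : Fin m => P₁) =
      (Measure.pi fun _ : Fin m => P₀).withDensity fun y => ∏ i, Λ (y i) := by
    rw [← pi_withDensity_prod P₀ H.measurable, H.withDensity_eq]
  calc _ = Measure.pi (fun _ : Fin m => P₁) {y | c ≤ ∏ i, Λ (y i) ∧ ∏ i, Λ (y i) ≤ C} := by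
        rw [← hres, Measure.map_apply hφ hA]
        simp only [hpre, Set.preimage_ofPred_eq]
    _ ≤ ∫⁻ _ in {y | c ≤ ∏ i, Λ (y i) ∧ ∏ i, Λ (y i) ≤ C}, C
          ∂(Measure.pi fun _ : Fin m => P₀) := by
        rw [hpi, withDensity_apply _ hA]
        exact setLIntegral_mono measurable_const fun y hy => hy.2
    _ ≤ C * Measure.pi (fun _ : Fin m => P₀) {y | c ≤ ∏ i, Λ (y i)} := by
        rw [setLIntegral_const]
        gcongr
        exact And.left
    _ = _ := by
        rw [← hres, Measure.map_apply hφ (measurableSet_le measurable_const hprod)]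
        simp only [hpre, Set.preimage_ofPred_eq]

/-- The event is typical under `P₁` but rare under `P₀`: its part with likelihood ratio at most
exp(m I (1 + δ)) has `P₁`-probability at least 1/2, and tilting back divides by at most that ratio.
-/
lemma eventually_le_measure_le_prod (H : IsLikelihoodRatio P₀ P₁ Λ I) {δ : ℝ} (hδ : 0 < δ) :
    ∀ᶠ m : ℕ in atTop, ENNReal.ofReal (2⁻¹ * Real.exp (-(m * (I * (1 + δ))))) ≤
      Measure.infinitePi (fun _ : ℕ => P₀)
        {x | ENNReal.ofReal (Real.exp (m * (I * (1 - δ)))) ≤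
          ∏ i ∈ Finset.range m, Λ (x i)} := by
  -- Two events of probability above 3/4 meet with probability at least 3/4 + 3/4 - 1 = 1/2.
  have h1 := (tendsto_order.1 (H.tendsto_measure_expCusum_le hδ)).1 (3 / 4)
    (ENNReal.div_lt_of_lt_mul (by norm_num))
  have h2 := (tendsto_order.1 (H.tendsto_measure_le_prod hδ)).1 (3 / 4)
    (ENNReal.div_lt_of_lt_mul (by norm_num))
  filter_upwards [h1, h2] with m hm1 hm2
  set Q := Measure.infinitePi fun _ : ℕ => P₁
  set A := {x | ∀ t ≤ m, expCusum Λ x t ≤ ENNReal.ofReal (Real.exp (m * (I * (1 + δ))))}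
  set B := {x : ℕ → 𝒳 | ENNReal.ofReal (Real.exp (m * (I * (1 - δ)))) ≤
    ∏ i ∈ Finset.range m, Λ (x i)}
  have h3 : 2⁻¹ ≤ Q (B ∩ A) := by
    have h4 := measure_union_add_inter B (μ := Q)
      (measurableSet_forall_expCusum_le H.measurable m
        (ENNReal.ofReal (Real.exp (m * (I * (1 + δ))))))
    have h5 : Q (B ∪ A) ≤ 1 := prob_le_one
    by_contra! h6
    have h7 : Q B + Q A < 1 + 2⁻¹ := by
      rw [← h4]
      exact ENNReal.add_lt_add_of_le_of_lt (measure_ne_top _ _) h5 h6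
    have h8 : (3 / 4 + 3 / 4 : ℝ≥0∞) = 1 + 2⁻¹ := by
      rw [← ENNReal.toReal_eq_toReal_iff' (by finiteness) (by finiteness)]
      rw [ENNReal.toReal_add (by finiteness) (by finiteness),
        ENNReal.toReal_add (by finiteness) (by finiteness)]
      norm_num
    rw [← h8] at h7
    exact (add_le_add hm2.le hm1.le).not_gt h7
  have h9 := H.measure_prod_mem_Icc_le m (ENNReal.ofReal (Real.exp (m * (I * (1 - δ)))))
    (ENNReal.ofReal (Real.exp (m * (I * (1 + δ)))))
  have h10 : Q (B ∩ A) ≤ Q {x | ENNReal.ofReal (Real.exp (m * (I * (1 - δ)))) ≤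
      ∏ i ∈ Finset.range m, Λ (x i) ∧
      ∏ i ∈ Finset.range m, Λ (x i) ≤ ENNReal.ofReal (Real.exp (m * (I * (1 + δ))))} := by
    refine measure_mono fun x hx => ⟨hx.1, ?_⟩
    have := prod_le_expCusum Λ x 0 m
    simp only [zero_add] at this
    exact this.trans (hx.2 m le_rfl)
  have h11 := (h3.trans h10).trans h9
  rw [mul_comm, ENNReal.ofReal_mul (Real.exp_pos _).le, Real.exp_neg,
    ENNReal.ofReal_inv_of_pos (Real.exp_pos _), ENNReal.ofReal_inv_of_pos (by norm_num)]
  rw [mul_comm, ← div_eq_mul_inv, ENNReal.div_le_iff_le_mul (by simp [Real.exp_pos]) (by simp)]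
  simpa [mul_comm] using h11

end IsLikelihoodRatio

/-! ### Independent sensors, and waiting for a successful block. -/

section JointLaw

open ProbabilityTheory

variable {𝒳 ι : Type*} [MeasurableSpace 𝒳] [Fintype ι] (P : ℕ → ι → Measure 𝒳)
  [∀ t k, IsProbabilityMeasure (P t k)]

/-- The law of independent observations, the one at time `t` in sensor `k` having law `P t k`. -/
noncomputable def jointLaw : Measure (ℕ → ι → 𝒳) :=
  Measure.infinitePi fun t => Measure.pi (P t)

instance : IsProbabilityMeasure (jointLaw P) := by
  unfold jointLaw; infer_instance

/-- Swapping time and sensor exhibits the sensors as independent sequences; the shift by `a` serves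
blocks that start after a change. -/
lemma jointLaw_map_sensors (a : ℕ) :
    (jointLaw P).map (fun x (k : ι) (i : ℕ) => x (a + i) k) =
      Measure.infinitePi fun k => Measure.infinitePi fun i => P (a + i) k := by
  have hinj : Function.Injective fun p : ι × ℕ => ((a + p.2, p.1) : ℕ × ι) := by
    rintro ⟨k, i⟩ ⟨l, j⟩ h
    simp only [Prod.mk.injEq, Nat.add_left_cancel_iff] at h
    simp [h]
  rw [← Measure.infinitePi_map_curry (fun k i => P (a + i) k),
    ← Measure.map_infinitePi_infinitePi_of_inj (P := fun p : ℕ × ι => P p.1 p.2) hinj,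
    ← Measure.infinitePi_map_curry_symm P, Measure.map_map (by fun_prop) (by fun_prop),
    Measure.map_map (by fun_prop) (by fun_prop)]
  simp only [Measure.infinitePi_eq_pi, jointLaw]
  rfl

lemma jointLaw_forall_mem (a : ℕ) (s : Finset ι) {A : Set (ℕ → 𝒳)} (hA : MeasurableSet A) :
    jointLaw P {x | ∀ k ∈ s, (fun i => x (a + i) k) ∈ A} =
      ∏ k ∈ s, Measure.infinitePi (fun i => P (a + i) k) A := by
  rw [← Measure.infinitePi_pi (μ := fun k => Measure.infinitePi fun i => P (a + i) k)
    (s := s) (t := fun _ => A) (fun _ _ => hA), ← jointLaw_map_sensors,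
    Measure.map_apply (by fun_prop) (.pi s.countable_toSet fun _ _ => hA)]
  rfl

lemma jointLaw_mem (k : ι) {A : Set (ℕ → 𝒳)} (hA : MeasurableSet A) :
    jointLaw P {x | (fun i => x i k) ∈ A} = Measure.infinitePi (fun i => P i k) A := by
  simpa using jointLaw_forall_mem P 0 {k} hA

lemma lintegral_jointLaw_prod (s : Finset ι) {F : (ℕ → 𝒳) → ℝ≥0∞} (hF : Measurable F) :
    ∫⁻ x, ∏ k ∈ s, F (fun i => x i k) ∂(jointLaw P) =
      ∏ k ∈ s, ∫⁻ y, F y ∂(Measure.infinitePi fun i => P i k) := by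
  have h0 := jointLaw_map_sensors P 0
  simp only [zero_add] at h0
  have hind := iIndepFun_infinitePi (P := fun k => Measure.infinitePi fun i => P i k)
    (X := fun _ y => F y) fun _ => hF
  have h1 := lintegral_prod_eq_prod_lintegral_of_indepFun s _ hind
    fun k => hF.comp (measurable_pi_apply k)
  have hprod : Measurable fun y : ι → ℕ → 𝒳 => ∏ k ∈ s, F (y k) :=
    Finset.measurable_prod _ fun k _ => hF.comp (measurable_pi_apply k)
  have h2 : ∫⁻ x, ∏ k ∈ s, F (fun i => x i k) ∂(jointLaw P) =
      ∫⁻ y, ∏ k ∈ s, F (y k) ∂(Measure.infinitePi fun k => Measure.infinitePi fun i => P i k) := by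
    rw [← h0, lintegral_map hprod (by fun_prop)]
  rw [h2, h1]
  refine Finset.prod_congr rfl fun k _ => ?_
  rw [← lintegral_map hF (measurable_pi_apply k)]
  congr 1
  exact Measure.infinitePi_map_eval (fun k => Measure.infinitePi fun i => P i k) k

/-- The event that in all sensors of `s` the likelihood ratio of the block of `m` observations
that starts after time `a` is at least `c`. -/
def blockEvent (Λ : 𝒳 → ℝ≥0∞) (s : Finset ι) (c : ℝ≥0∞) (m a : ℕ) : Set (ℕ → ι → 𝒳) :=
  {x | ∀ k ∈ s, c ≤ ∏ i ∈ Finset.range m, Λ (x (a + i) k)}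

/-- The event that the first `j` blocks of `m` observations after time `a` all fail. -/
def failEvent (Λ : 𝒳 → ℝ≥0∞) (s : Finset ι) (c : ℝ≥0∞) (m a j : ℕ) : Set (ℕ → ι → 𝒳) :=
  {x | ∀ i < j, x ∉ blockEvent Λ s c m (a + i * m)}

variable {Λ : 𝒳 → ℝ≥0∞} (s : Finset ι) (c : ℝ≥0∞) (m a : ℕ)

lemma measurableSet_blockEvent (hΛ : Measurable Λ) :
    MeasurableSet (blockEvent Λ s c m a) := by
  simp only [blockEvent, Set.ofPred_forall]
  exact .iInter fun k => .iInter fun _ => measurableSet_le measurable_const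
    (Finset.measurable_prod _ fun i _ => hΛ.comp (by fun_prop))

lemma measurableSet_failEvent (hΛ : Measurable Λ) (j : ℕ) :
    MeasurableSet (failEvent Λ s c m a j) := by
  simp only [failEvent, Set.ofPred_forall]
  exact .iInter fun i => .iInter fun _ => (measurableSet_blockEvent s c m _ hΛ).compl

omit [MeasurableSpace 𝒳] [Fintype ι] in
lemma dependsOn_mem_blockEvent :
    DependsOn (fun x => x ∈ blockEvent Λ s c m a) (Finset.Ico a (a + m) : Set ℕ) := by
  intro x y hxy
  have : ∀ k, ∏ i ∈ Finset.range m, Λ (x (a + i) k) = ∏ i ∈ Finset.range m, Λ (y (a + i) k) :=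
    fun k => Finset.prod_congr rfl fun i hi => by
      rw [hxy (a + i) (by simpa using hi)]
  simp only [blockEvent, Set.mem_ofPred_eq, this]

omit [MeasurableSpace 𝒳] [Fintype ι] in
lemma dependsOn_mem_failEvent (j : ℕ) :
    DependsOn (fun x => x ∈ failEvent Λ s c m a j) (Finset.range (a + j * m) : Set ℕ) := by
  intro x y hxy
  have : ∀ i < j, (x ∈ blockEvent Λ s c m (a + i * m)) = (y ∈ blockEvent Λ s c m (a + i * m)) :=
    fun i hi => dependsOn_mem_blockEvent s c m _ fun t ht => hxy t (by
      have h1 : (i + 1) * m ≤ j * m := Nat.mul_le_mul_right m hi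
      simp only [Finset.coe_Ico, Set.mem_Ico, Finset.coe_range, Set.mem_Iio] at ht ⊢
      linarith [ht.2])
  refine propext (forall₂_congr fun i hi => ?_)
  rw [this i hi]

lemma measure_inter_eq_mul_of_dependsOn {E : Type*} [MeasurableSpace E] (μ : ℕ → Measure E)
    [∀ i, IsProbabilityMeasure (μ i)] {S T : Finset ℕ} (hST : Disjoint S T) {A D : Set (ℕ → E)}
    (hA : MeasurableSet A) (hD : MeasurableSet D) (hAS : DependsOn (· ∈ A) (S : Set ℕ))
    (hDT : DependsOn (· ∈ D) (T : Set ℕ)) :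
    Measure.infinitePi μ (A ∩ D) = Measure.infinitePi μ A * Measure.infinitePi μ D := by
  have : Nonempty E := nonempty_of_isProbabilityMeasure (μ 0)
  have hind := indepFun_of_dependsOn μ hST (measurable_mem.2 hA) (measurable_mem.2 hD) hAS hDT
  have := hind.measure_inter_preimage_eq_mul {True} {True} trivial trivial
  simpa [Set.preimage] using this

lemma measure_inter_failEvent_le (hΛ : Measurable Λ) {p : ℝ≥0∞} {A : Set (ℕ → ι → 𝒳)}
    (hA : MeasurableSet A) (hAa : DependsOn (· ∈ A) (Finset.range a : Set ℕ))
    (hp : ∀ j, p ≤ jointLaw P (blockEvent Λ s c m (a + j * m))) (j : ℕ) :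
    jointLaw P (A ∩ failEvent Λ s c m a j) ≤ jointLaw P A * (1 - p) ^ j := by
  induction j with
  | zero => simpa using measure_mono Set.inter_subset_left
  | succ j ih =>
    have hsucc : A ∩ failEvent Λ s c m a (j + 1) =
        (A ∩ failEvent Λ s c m a j) ∩ (blockEvent Λ s c m (a + j * m))ᶜ := by
      ext x
      simp only [failEvent, Set.mem_inter_iff, Set.mem_ofPred_eq, Set.mem_compl_iff,
        Nat.lt_succ_iff_lt_or_eq, or_imp, forall_and, forall_eq, and_assoc]
    have hdep : DependsOn (· ∈ A ∩ failEvent Λ s c m a j)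
        (Finset.range (a + j * m) : Set ℕ) := by
      intro x y hxy
      have h1 := hAa (x := x) (y := y) fun i hi => hxy i (by simp at hi ⊢; omega)
      have h2 := dependsOn_mem_failEvent (Λ := Λ) s c m a j hxy
      simp only at h1 h2
      simp only [Set.mem_inter_iff, h1, h2]
    have hdep' : DependsOn (· ∈ (blockEvent Λ s c m (a + j * m))ᶜ)
        (Finset.Ico (a + j * m) (a + j * m + m) : Set ℕ) := by
      intro x y hxy
      have := dependsOn_mem_blockEvent (Λ := Λ) s c m (a + j * m) hxy
      simp only at this
      simp only [Set.mem_compl_iff, this]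
    have hdisj : Disjoint (Finset.range (a + j * m))
        (Finset.Ico (a + j * m) (a + j * m + m)) := by
      rw [Finset.disjoint_left]
      intro i hi hi'
      simp only [Finset.mem_range, Finset.mem_Ico] at hi hi'
      omega
    have hb := measurableSet_blockEvent s c m (a + j * m) hΛ
    rw [hsucc, jointLaw, measure_inter_eq_mul_of_dependsOn (fun t => Measure.pi (P t)) hdisj
      (hA.inter (measurableSet_failEvent s c m a hΛ j)) hb.compl hdep hdep', ← jointLaw, pow_succ,
      ← mul_assoc, prob_compl_eq_one_sub hb]
    gcongr
    exact hp j

/-- Each block succeeds with probability at least `p`, independently of `A` and of earlier blocks,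
so the waiting time is `m` times a variable dominated by a geometric one. Letting `A` range over
past events is what later bounds the conditional expectation. -/
lemma setLIntegral_le_of_blockEvent (hΛ : Measurable Λ) {p : ℝ≥0∞} (hp1 : p ≤ 1)
    {A : Set (ℕ → ι → 𝒳)} (hA : MeasurableSet A)
    (hAa : DependsOn (· ∈ A) (Finset.range a : Set ℕ)) (hm : 1 ≤ m)
    (hp : ∀ j, p ≤ jointLaw P (blockEvent Λ s c m (a + j * m))) {V : (ℕ → ι → 𝒳) → ℕ∞}
    (hV : ∀ x j, x ∈ blockEvent Λ s c m (a + j * m) → V x ≤ ((j + 1) * m : ℕ)) :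
    ∫⁻ x in A, (V x : ℝ≥0∞) ∂(jointLaw P) ≤ m * p⁻¹ * jointLaw P A := by
  classical
  -- If block `j` is the first success, the fail events of index 0, ..., `j` hold (index 0 is
  -- vacuous), which counts `j + 1` blocks. Without a success the series is infinite.
  have hpt : ∀ x, (V x : ℝ≥0∞) ≤
      ∑' j, (failEvent Λ s c m a j).indicator (fun _ => (m : ℝ≥0∞)) x := by
    intro x
    by_cases hx : ∃ j, x ∈ blockEvent Λ s c m (a + j * m)
    · have h1 : (V x : ℝ≥0∞) ≤ (((Nat.find hx + 1) * m : ℕ) : ℝ≥0∞) := by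
        exact_mod_cast ENat.toENNReal_le.2 (hV x _ (Nat.find_spec hx))
      refine h1.trans ((le_of_eq ?_).trans
        (ENNReal.sum_le_tsum (Finset.range (Nat.find hx + 1))))
      rw [Finset.sum_congr rfl (g := fun _ => (m : ℝ≥0∞))]
      · simp
      · intro j hj
        have hmem : x ∈ failEvent Λ s c m a j := fun i hi =>
          Nat.find_min hx (hi.trans_le (Nat.lt_succ_iff.1 (Finset.mem_range.1 hj)))
        exact Set.indicator_of_mem hmem _
    · have h2 : ∀ j, (failEvent Λ s c m a j).indicator (fun _ => (m : ℝ≥0∞)) x = m := fun j => by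
        have hmem : x ∈ failEvent Λ s c m a j := fun i _ hi => hx ⟨i, hi⟩
        exact Set.indicator_of_mem hmem _
      simp only [h2]
      rw [ENNReal.tsum_const_eq_top_of_ne_zero (by exact_mod_cast (by omega : m ≠ 0))]
      exact le_top
  calc _ ≤ ∫⁻ x in A, ∑' j, (failEvent Λ s c m a j).indicator (fun _ => (m : ℝ≥0∞)) x
          ∂(jointLaw P) := lintegral_mono hpt
    _ = ∑' j, m * jointLaw P (A ∩ failEvent Λ s c m a j) := by
      rw [lintegral_tsum fun j => (measurable_const.indicator
        (measurableSet_failEvent s c m a hΛ j)).aemeasurable]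
      refine tsum_congr fun j => ?_
      rw [lintegral_indicator (measurableSet_failEvent s c m a hΛ j), setLIntegral_const,
        Measure.restrict_apply (measurableSet_failEvent s c m a hΛ j), Set.inter_comm]
    _ ≤ ∑' j, m * (jointLaw P A * (1 - p) ^ j) := by
      gcongr with j
      exact measure_inter_failEvent_le P s c m a hΛ hA hAa hp j
    _ = _ := by
      rw [ENNReal.tsum_mul_left, ENNReal.tsum_mul_left, ENNReal.tsum_geometric,
        ENNReal.sub_sub_cancel ENNReal.one_ne_top hp1, mul_comm (jointLaw P A), mul_assoc]

end JointLaw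

/-! ### Measurability and the stopping time property. -/

section StoppingTime

variable {𝒳 : Type*} [MeasurableSpace 𝒳] {ι : Type*} [Fintype ι] {f g : 𝒳 → ℝ≥0} {L : ℕ}
  {h : ℝ}

lemma measurable_likelihoodRatio (hf : Measurable f) (hg : Measurable g) :
    Measurable (likelihoodRatio f g) :=
  hg.coe_nnreal_ennreal.div hf.coe_nnreal_ennreal

lemma measurableSet_lowSumCusum_le (hf : Measurable f) (hg : Measurable g)
    (hL : L ≤ Fintype.card ι) (m : ℕ) :
    MeasurableSet {x : ℕ → ι → 𝒳 | lowSumCusum f g L h x ≤ m} := by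
  simp only [lowSumCusum_le_iff, le_sumSmallest_iff hL, cusum_eq_log_expCusum, ← log_finset_prod,
    Set.ofPred_exists, Set.ofPred_and, Set.ofPred_forall]
  refine .iUnion fun t => .inter (.const _) (.inter (.const _) ?_)
  refine .iInter fun s => .iInter fun _ => measurableSet_le measurable_const ?_
  exact ENNReal.measurable_log.comp (Finset.measurable_prod _ fun k _ =>
    (measurable_expCusum (measurable_likelihoodRatio hf hg) t).comp (by fun_prop))

lemma measurable_lowSumCusum (hf : Measurable f) (hg : Measurable g) (hL : L ≤ Fintype.card ι) :
    Measurable fun x : ℕ → ι → 𝒳 => lowSumCusum f g L h x := by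
  have hle := fun m : ℕ => measurableSet_lowSumCusum_le (h := h) hf hg hL m
  refine measurable_to_countable' fun a => ?_
  induction a using ENat.recTopCoe with
  | top =>
    convert (MeasurableSet.iUnion hle).compl using 1
    ext x
    simp only [Set.mem_preimage, Set.mem_singleton_iff, Set.mem_compl_iff, Set.mem_iUnion,
      Set.mem_ofPred_eq, not_exists, not_le]
    refine ⟨fun hx m => hx ▸ ENat.natCast_lt_top m, fun hx => ?_⟩
    by_contra hne
    obtain ⟨m, hm⟩ := ENat.ne_top_iff_exists.1 hne
    exact (hx m).ne hm
  | coe m =>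
    convert (hle m).inter (MeasurableSet.iInter fun i => MeasurableSet.iInter fun _ : i < m =>
      (hle i).compl) using 1
    ext x
    simp only [Set.mem_preimage, Set.mem_singleton_iff, Set.mem_inter_iff, Set.mem_iInter,
      Set.mem_compl_iff, Set.mem_ofPred_eq, not_le]
    refine ⟨fun hx => ⟨hx.le, fun i hi => hx ▸ by exact_mod_cast hi⟩, fun hx => ?_⟩
    refine le_antisymm hx.1 (not_lt.1 fun hlt => ?_)
    obtain ⟨i, hi⟩ := ENat.ne_top_iff_exists.1 (ne_top_of_lt hlt)
    rw [← hi] at hlt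
    exact (hx.2 i (by exact_mod_cast hlt)).ne hi

omit [MeasurableSpace 𝒳] in
lemma dependsOn_lowSumCusum_le (m : ℕ) :
    DependsOn (fun x : ℕ → ι → 𝒳 => lowSumCusum f g L h x ≤ m) (Finset.range m : Set ℕ) := by
  intro x y hxy
  simp only [lowSumCusum_le_iff, cusum_eq_log_expCusum]
  refine propext (exists_congr fun t => and_congr_right fun _ => and_congr_right fun htm => ?_)
  have : ∀ k, expCusum (likelihoodRatio f g) (fun s => x s k) t =
      expCusum (likelihoodRatio f g) (fun s => y s k) t := fun k =>
    expCusum_congr _ fun i hi => by rw [hxy i (by simp; omega)]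
  simp only [this]

lemma measurableSet_obsFiltration {K : ℕ} [Nonempty 𝒳] {t : ℕ} {A : Set (ℕ → Fin K → 𝒳)}
    (hA : MeasurableSet A) (hAt : DependsOn (· ∈ A) (Finset.range t : Set ℕ)) :
    MeasurableSet[obsFiltration 𝒳 K t] A := by
  obtain ⟨e⟩ := ‹Nonempty 𝒳›
  let ext (y : Fin t → Fin K → 𝒳) (i : ℕ) : Fin K → 𝒳 := if h : i < t then y ⟨i, h⟩ else fun _ => e
  have hext : Measurable ext := by
    refine measurable_pi_lambda _ fun i => ?_
    by_cases h : i < t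
    · simpa only [ext, h, dite_true] using measurable_pi_apply _
    · simpa only [ext, h, dite_false] using measurable_const
  refine ⟨ext ⁻¹' A, hext hA, ?_⟩
  ext x
  have := hAt (x := ext fun s : Fin t => x s) (y := x) fun i hi => by
    simp [ext, Finset.mem_range.1 (Finset.mem_coe.1 hi)]
  simpa using this

lemma isStoppingTime_lowSumCusum {K : ℕ} [Nonempty 𝒳] (hf : Measurable f) (hg : Measurable g)
    (hL : L ≤ K) :
    IsStoppingTime (obsFiltration 𝒳 K) (lowSumCusum (ι := Fin K) f g L h) := fun m =>
  measurableSet_obsFiltration (measurableSet_lowSumCusum_le hf hg (by simpa using hL) m)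
    (dependsOn_lowSumCusum_le m)

end StoppingTime

/-! ### Adversarial observations, the false alarm constraint and block bounds. -/

section SensorLaw

variable {𝒳 : Type*} [MeasurableSpace 𝒳] {K : ℕ} {lam : Measure 𝒳} {f g : 𝒳 → ℝ≥0}
  {N B : Finset (Fin K)} {L : ℕ} {h : ℝ}

/-- The law of the observation at time `t + 1` in the honest sensor `k`. -/
noncomputable def honestMarginal (lam : Measure 𝒳) (f g : 𝒳 → ℝ≥0) (N B : Finset (Fin K))
    (nu : ℕ∞) (t : ℕ) (k : N) : Measure 𝒳 :=
  if (k : Fin K) ∈ B ∧ nu < ((t + 1 : ℕ) : ℕ∞) then densityMeasure lam g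
  else densityMeasure lam f

lemma honestLaw_eq_jointLaw (nu : ℕ∞) :
    honestLaw lam f g N B nu = jointLaw (honestMarginal lam f g N B nu) := rfl

instance (nu : ℕ∞) (t : ℕ) (k : N) [IsProbabilityMeasure (densityMeasure lam f)]
    [IsProbabilityMeasure (densityMeasure lam g)] :
    IsProbabilityMeasure (honestMarginal lam f g N B nu t k) := by
  unfold honestMarginal; split_ifs <;> infer_instance

lemma observe_comp_val (π : Strategy 𝒳 N) (x : ℕ → N → 𝒳) :
    (fun t (k : N) => observe π x t k) = x := by
  ext t k
  simp [observe]

lemma lowSumCusum_le_lowSumCusum_observe (hL : L ≤ N.card) (π : Strategy 𝒳 N)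
    (x : ℕ → N → 𝒳) :
    lowSumCusum f g L h x ≤ lowSumCusum f g L h (observe π x) := by
  have := lowSumCusum_comp_le (f := f) (g := g) (h := h) (L := L) (e := fun k : N => (k : Fin K))
    (by simpa using hL) Subtype.val_injective (observe π x)
  rwa [observe_comp_val] at this

lemma lintegral_sensorLaw (nu : ℕ∞) (π : Strategy 𝒳 N) {F : (ℕ → Fin K → 𝒳) → ℝ≥0∞}
    (hF : Measurable F) :
    ∫⁻ x, F x ∂(sensorLaw lam f g N B nu π) = ∫⁻ x, F (observe π x) ∂(honestLaw lam f g N B nu) :=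
  lintegral_map hF (measurable_observe π)

lemma measurable_lowSumCusum_toENNReal (hf : Measurable f) (hg : Measurable g) (hL : L ≤ K)
    (nu : ℕ) :
    Measurable fun x : ℕ → Fin K → 𝒳 =>
      ((lowSumCusum f g L h x - (nu : ℕ∞) : ℕ∞) : ℝ≥0∞) :=
  (measurable_of_countable fun n : ℕ∞ => ((n - (nu : ℕ∞) : ℕ∞) : ℝ≥0∞)).comp
    (measurable_lowSumCusum hf hg (by simpa using hL))

theorem lowSumCusum_mem_ruleClass [Nonempty 𝒳] (hf : Measurable f) (hg : Measurable g)
    (hL : L ≤ N.card) {γ : ℝ}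
    (hγ : ∫⁻ x, (lowSumCusum f g L h x : ℝ≥0∞) ∂(honestLaw lam f g N ∅ ⊤) = ENNReal.ofReal γ) :
    lowSumCusum (ι := Fin K) f g L h ∈ ruleClass lam f g N γ := by
  have hLK : L ≤ K := hL.trans (by simpa using N.card_le_univ)
  refine ⟨isStoppingTime_lowSumCusum hf hg hLK, le_iInf fun π => ?_⟩
  have hm := measurable_lowSumCusum_toENNReal (h := h) hf hg hLK 0
  simp only [Nat.cast_zero, tsub_zero] at hm
  rw [lintegral_sensorLaw ⊤ π hm, ← hγ]
  exact lintegral_mono fun x => ENat.toENNReal_le.2 (lowSumCusum_le_lowSumCusum_observe hL π x)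

/-- The conditional expectation is `m`-measurable, so it suffices to compare integrals over sets of
`m`, with respect to the trimmed measure. -/
lemma condLExp_ae_le_of_forall_setLIntegral_le {Ω : Type*} {m m0 : MeasurableSpace Ω} (hm : m ≤ m0)
    (P : Measure Ω) [IsFiniteMeasure P] {X : Ω → ℝ≥0∞} {c : ℝ≥0∞}
    (hX : ∀ A, MeasurableSet[m] A → ∫⁻ x in A, X x ∂P ≤ c * P A) :
    ∀ᵐ x ∂P, condLExp m P X x ≤ c := by
  refine ae_le_of_ae_le_trim (hm := hm) (f₁ := condLExp m P X) (f₂ := fun _ => c) ?_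
  refine ae_le_of_forall_setLIntegral_le_of_sigmaFinite (measurable_condLExp m P X)
    fun A hA _ => ?_
  rw [setLIntegral_condLExp_trim hm P X hA, setLIntegral_const, trim_measurableSet_eq hm hA]
  exact hX A hA

variable [IsProbabilityMeasure (densityMeasure lam f)] [IsProbabilityMeasure (densityMeasure lam g)]

instance (nu : ℕ∞) : IsProbabilityMeasure (honestLaw lam f g N B nu) := by
  rw [honestLaw_eq_jointLaw]; infer_instance

instance (nu : ℕ∞) (π : Strategy 𝒳 N) : IsProbabilityMeasure (sensorLaw lam f g N B nu π) :=
  Measure.isProbabilityMeasure_map (measurable_observe π).aemeasurable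

/-- Strategies are non-anticipating: corrupt observations up to `nu` are functions of honest ones up
to `nu`. Hence the adversary's past is independent of honest observations after the change. -/
lemma dependsOn_mem_preimage_observe (π : Strategy 𝒳 N) {nu : ℕ} {A : Set (ℕ → Fin K → 𝒳)}
    (hA : MeasurableSet[obsFiltration 𝒳 K nu] A) :
    DependsOn (· ∈ observe π ⁻¹' A) (Finset.range nu : Set ℕ) := by
  obtain ⟨S, hS, rfl⟩ := hA
  intro x y hxy
  have : (fun s : Fin nu => observe π x s) = fun s : Fin nu => observe π y s := by
    funext s k
    have hs : ∀ i : ℕ, i ≤ s → x i = y i := fun i hi =>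
      hxy i (by simpa using lt_of_le_of_lt hi s.2)
    have h2 : (fun i : Fin (s + 1) => x i) = fun i : Fin (s + 1) => y i := by
      funext i
      exact hs i (Nat.lt_succ_iff.1 i.2)
    simp only [observe, hs s le_rfl, h2]
  simp only [Set.mem_preimage, this]

/-- The bound is uniform in the change-point and the strategy, because success of a block involves
only the sensors of `B` after `nu`. -/
theorem detectionDelay_le (hf : Measurable f) (hg : Measurable g) (hB : B ⊆ N) (hLK : L ≤ K)
    {c : ℝ} (hc : 0 ≤ c) (hh : h = (L + B.card - K : ℕ) * c) {m : ℕ} (hm : 1 ≤ m) :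
    detectionDelay lam f g N B (lowSumCusum (ι := Fin K) f g L h) ≤
      m * (Measure.infinitePi (fun _ : ℕ => densityMeasure lam g)
        {x | ENNReal.ofReal (Real.exp c) ≤
          ∏ i ∈ Finset.range m, likelihoodRatio f g (x i)} ^ B.card)⁻¹ := by
  classical
  refine iSup₂_le fun nu π => essSup_le_of_ae_le _ ?_
  refine condLExp_ae_le_of_forall_setLIntegral_le ((obsFiltration 𝒳 K).le nu) _ fun A hA => ?_
  have hΛ := measurable_likelihoodRatio hf hg
  have hA' := (obsFiltration 𝒳 K).le nu A hA
  rw [sensorLaw, setLIntegral_map hA' (measurable_lowSumCusum_toENNReal hf hg hLK nu)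
    (measurable_observe π), Measure.map_apply (measurable_observe π) hA', honestLaw_eq_jointLaw]
  set s : Finset N := B.subtype (· ∈ N) with hs
  have hscard : s.card = B.card := by
    rw [hs, Finset.card_subtype, Finset.filter_true_of_mem fun k hk => hB hk]
  refine setLIntegral_le_of_blockEvent _ s (ENNReal.ofReal (Real.exp c)) m nu hΛ
    (pow_le_one' prob_le_one _) (measurable_observe π hA') (dependsOn_mem_preimage_observe π hA)
    hm (fun j => ?_) (V := fun x => lowSumCusum f g L h (observe π x) - (nu : ℕ∞))
    (fun x j hx => ?_)
  · have hset := measurableSet_le_prod hΛ m (ENNReal.ofReal (Real.exp c))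
    refine le_of_eq ((Eq.trans ?_ (jointLaw_forall_mem _ (nu + j * m) s hset).symm))
    rw [Finset.prod_congr rfl (g := fun _ =>
      Measure.infinitePi (fun _ : ℕ => densityMeasure lam g)
        {x | ENNReal.ofReal (Real.exp c) ≤
          ∏ i ∈ Finset.range m, likelihoodRatio f g (x i)})]
    · rw [Finset.prod_const, hscard]
    · intro k hk
      have : (fun i => honestMarginal lam f g N B nu (nu + j * m + i) k) =
          fun _ => densityMeasure lam g := by
        funext i
        rw [honestMarginal, if_pos]
        refine ⟨by simpa [hs] using hk, ?_⟩
        -- Coordinate `t` is observed at time `t + 1`, so coordinate `nu` is already the first one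
        -- after the change.
        exact_mod_cast (by omega : nu < nu + j * m + i + 1)
      rw [this]
  · rw [tsub_le_iff_left]
    have h1 : lowSumCusum f g L h (observe π x) ≤ ((nu + j * m + m : ℕ) : ℕ∞) := by
      refine lowSumCusum_le_of_expCusum (s := B) (by simpa using hLK) hc (by simpa using hh)
        (by omega) fun k hk => ?_
      refine le_trans ?_ (prod_le_expCusum _ _ (nu + j * m) m)
      have h2 := hx ⟨k, hB hk⟩ (by simpa [hs] using hk)
      simpa [observe, hB hk] using h2
    refine h1.trans (le_of_eq ?_)
    push_cast
    ring

theorem lintegral_lowSumCusum_le (hf : Measurable f) (hg : Measurable g) (hL1 : 1 ≤ L)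
    (hL : L ≤ N.card) (hh : 0 ≤ h) {m : ℕ} (hm : 1 ≤ m) :
    ∫⁻ x, (lowSumCusum f g L h x : ℝ≥0∞) ∂(honestLaw lam f g N ∅ ⊤) ≤
      m * (Measure.infinitePi (fun _ : ℕ => densityMeasure lam f)
        {x | ENNReal.ofReal (Real.exp (h / L)) ≤
          ∏ i ∈ Finset.range m, likelihoodRatio f g (x i)} ^ N.card)⁻¹ := by
  have hΛ := measurable_likelihoodRatio hf hg
  have hL0 : (L : ℝ) ≠ 0 := by positivity
  have hset := measurableSet_le_prod hΛ m (ENNReal.ofReal (Real.exp (h / L)))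
  have key := setLIntegral_le_of_blockEvent (honestMarginal lam f g N ∅ ⊤) Finset.univ
    (ENNReal.ofReal (Real.exp (h / L))) m 0 hΛ (A := Set.univ)
    (p := Measure.infinitePi (fun _ : ℕ => densityMeasure lam f)
        {x | ENNReal.ofReal (Real.exp (h / L)) ≤
          ∏ i ∈ Finset.range m, likelihoodRatio f g (x i)} ^ N.card)
    (pow_le_one' prob_le_one _) .univ (fun x y _ => by simp) hm (fun j => ?_)
    (V := fun x => lowSumCusum f g L h x) (fun x j hx => ?_)
  · simpa [honestLaw_eq_jointLaw] using key
  · refine le_of_eq ((Eq.trans ?_ (jointLaw_forall_mem _ (0 + j * m) Finset.univ hset).symm))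
    simp [honestMarginal]
  · refine lowSumCusum_le_of_expCusum (s := Finset.univ) (c := h / L) (by simpa using hL)
      (by positivity) ?_ (by nlinarith) fun k hk => ?_
    · simp only [Finset.card_univ, add_tsub_cancel_right]
      field_simp
    · have h2 := hx k hk
      have h3 := h2.trans (prod_le_expCusum _ (fun i => x i k) (0 + j * m) m)
      rwa [zero_add, ← Nat.succ_mul] at h3

end SensorLaw

lemma succ_mul_one_sub_le_lintegral {Ω : Type*} [MeasurableSpace Ω] (μ : Measure Ω)
    [IsProbabilityMeasure μ] {V : Ω → ℕ∞} {m : ℕ} (hV : MeasurableSet {x | V x ≤ m}) :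
    ((m + 1 : ℕ) : ℝ≥0∞) * (1 - μ {x | V x ≤ m}) ≤ ∫⁻ x, (V x : ℝ≥0∞) ∂μ := by
  rw [← prob_compl_eq_one_sub hV, ← setLIntegral_const]
  refine (setLIntegral_mono' hV.compl fun x hx => ?_).trans (setLIntegral_le_lintegral _ _)
  have h1 : ((m + 1 : ℕ) : ℕ∞) ≤ V x := by
    have : (m : ℕ∞) < V x := not_le.1 hx
    exact_mod_cast Order.add_one_le_of_lt this
  exact_mod_cast ENat.toENNReal_le.2 h1

/-! ### Exponential tail bound for unaffected sensors. -/

section Tail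

variable {𝒳 ι : Type*} [MeasurableSpace 𝒳] [Fintype ι] (P : ℕ → ι → Measure 𝒳)
  [∀ t k, IsProbabilityMeasure (P t k)] {P₀ P₁ : Measure 𝒳} [IsProbabilityMeasure P₀]
  [IsProbabilityMeasure P₁] {Λ : 𝒳 → ℝ≥0∞} {I : ℝ}

/-- Markov's inequality for the θ-th power of the product, whose mean factorizes over sensors,
followed by a union bound over the `m + 1` times. -/
lemma IsLikelihoodRatio.exists_jointLaw_prod_expCusum_le (H : IsLikelihoodRatio P₀ P₁ Λ I)
    {s : Finset ι} (hs : ∀ t, ∀ k ∈ s, P t k = P₀) {θ : ℝ} (hθ0 : 0 < θ) (hθ1 : θ < 1) :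
    ∃ C : ℝ, 1 ≤ C ∧ ∀ (z : ℝ) (m : ℕ),
      jointLaw P {x | ∃ t ≤ m, ENNReal.ofReal (Real.exp z) ≤
        ∏ k ∈ s, expCusum Λ (fun i => x i k) t} ≤
      ENNReal.ofReal ((m + 1) * (C * Real.exp (-(θ * z)))) := by
  set D := (1 - ∫⁻ x, Λ x ^ θ ∂P₀)⁻¹ with hD
  have hD1 : 1 ≤ D := ENNReal.one_le_inv.2 tsub_le_self
  have hDt : D ≠ ⊤ := ENNReal.inv_ne_top.2 (tsub_pos_of_lt (H.lintegral_rpow_lt_one hθ0 hθ1)).ne'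
  have hDpow : D ^ s.card ≠ ⊤ := ENNReal.pow_ne_top hDt
  refine ⟨(D ^ s.card).toReal, ?_, fun z m => ?_⟩
  · rw [← ENNReal.toReal_one]
    exact ENNReal.toReal_mono hDpow (one_le_pow_of_one_le' hD1 _)
  have hone : ∀ t, jointLaw P {x | ENNReal.ofReal (Real.exp z) ≤
      ∏ k ∈ s, expCusum Λ (fun i => x i k) t} ≤
      ENNReal.ofReal ((D ^ s.card).toReal * Real.exp (-(θ * z))) := by
    intro t
    have hF := (measurable_expCusum H.measurable t).pow_const θ
    have h1 : ∫⁻ x, ∏ k ∈ s, expCusum Λ (fun i => x i k) t ^ θ ∂(jointLaw P) ≤ D ^ s.card := by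
      rw [lintegral_jointLaw_prod P s hF]
      refine (Finset.prod_le_pow_card s _ D fun k hk => ?_)
      have : (fun i => P i k) = fun _ => P₀ := funext fun i => hs i k hk
      simp only [this]
      exact H.lintegral_expCusum_rpow_le hθ0 hθ1 t
    have hprod : Measurable fun x : ℕ → ι → 𝒳 => ∏ k ∈ s, expCusum Λ (fun i => x i k) t ^ θ :=
      Finset.measurable_prod _ fun k _ => hF.comp (by fun_prop)
    have h2 := (mul_meas_ge_le_lintegral (μ := jointLaw P) hprod
      (ENNReal.ofReal (Real.exp (θ * z)))).trans h1
    have h3 : {x : ℕ → ι → 𝒳 | ENNReal.ofReal (Real.exp z) ≤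
        ∏ k ∈ s, expCusum Λ (fun i => x i k) t} ⊆
        {x | ENNReal.ofReal (Real.exp (θ * z)) ≤
          ∏ k ∈ s, expCusum Λ (fun i => x i k) t ^ θ} := by
      intro x hx
      have h4 := ENNReal.monotone_rpow_of_nonneg hθ0.le (Set.mem_ofPred_eq ▸ hx)
      simp only at h4
      rw [ENNReal.ofReal_rpow_of_pos (Real.exp_pos _), ← Real.exp_mul, mul_comm z,
        ← ENNReal.prod_rpow_of_nonneg hθ0.le] at h4
      exact h4
    refine (measure_mono h3).trans ?_
    rw [Real.exp_neg, ← div_eq_mul_inv, ENNReal.ofReal_div_of_pos (Real.exp_pos _),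
      ENNReal.ofReal_toReal hDpow, ENNReal.le_div_iff_mul_le (by simp [Real.exp_pos]) (by simp),
      mul_comm]
    exact h2
  calc _ ≤ jointLaw P (⋃ t ∈ Finset.range (m + 1), {x | ENNReal.ofReal (Real.exp z) ≤
        ∏ k ∈ s, expCusum Λ (fun i => x i k) t}) := by
        refine measure_mono fun x hx => ?_
        obtain ⟨t, htm, ht⟩ := hx
        exact Set.mem_biUnion (Finset.mem_coe.2 (Finset.mem_range.2 (Nat.lt_succ_iff.2 htm))) ht
    _ ≤ ∑ t ∈ Finset.range (m + 1), ENNReal.ofReal ((D ^ s.card).toReal * Real.exp (-(θ * z))) :=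
        (measure_biUnion_finset_le _ _).trans (Finset.sum_le_sum fun t _ => hone t)
    _ = _ := by
        rw [Finset.sum_const, Finset.card_range, nsmul_eq_mul,
          ENNReal.ofReal_mul (p := (m : ℝ) + 1) (by positivity)]
        congr 1
        rw [← Nat.cast_succ, ENNReal.ofReal_natCast]

end Tail

/-! ### The four bounds with slack. -/

section Bounds

variable {𝒳 : Type*} [MeasurableSpace 𝒳] {K : ℕ} {lam : Measure 𝒳} {f g : 𝒳 → ℝ≥0}
  {N B : Finset (Fin K)} {L : ℕ} {I : ℝ}
  [IsProbabilityMeasure (densityMeasure lam f)] [IsProbabilityMeasure (densityMeasure lam g)]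

theorem exists_le_lintegral_lowSumCusum (hf : Measurable f) (hg : Measurable g)
    (H : IsLikelihoodRatio (densityMeasure lam f) (densityMeasure lam g) (likelihoodRatio f g) I)
    (hL1 : 1 ≤ L) (hL : L ≤ N.card) {θ : ℝ} (hθ0 : 0 < θ) (hθ1 : θ < 1) :
    ∃ C : ℝ, ∀ h : ℝ, ENNReal.ofReal (Real.exp (θ * (N.card / L * h) - C)) ≤
      ∫⁻ x, (lowSumCusum f g L h x : ℝ≥0∞) ∂(honestLaw lam f g N ∅ ⊤) := by
  have hLc : L ≤ Fintype.card N := by simpa using hL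
  obtain ⟨D, hD1, hD⟩ := H.exists_jointLaw_prod_expCusum_le (honestMarginal lam f g N ∅ ⊤)
    (s := Finset.univ) (fun t k _ => by simp [honestMarginal]) hθ0 hθ1
  have hD0 : 0 < D := by linarith
  refine ⟨Real.log (8 * D), fun h => ?_⟩
  set w := Real.exp (θ * (N.card / L * h)) with hw
  have hw0 : 0 < w := Real.exp_pos _
  rw [Real.exp_sub, Real.exp_log (by positivity), ← hw]
  -- For small `w` the rule's value is at least 1, which suffices. Otherwise m = ⌊w/(4D)⌋ makes the
  -- tail (m + 1) D/w at most 1/2.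
  rcases le_total w (4 * D) with hwD | hwD
  · calc ENNReal.ofReal (w / (8 * D)) ≤ ENNReal.ofReal 1 :=
          ENNReal.ofReal_le_ofReal (by rw [div_le_one (by positivity)]; linarith)
      _ = ∫⁻ _, 1 ∂(honestLaw lam f g N ∅ ⊤) := by simp
      _ ≤ _ := lintegral_mono fun x => by
          rw [← ENat.toENNReal_one]
          exact ENat.toENNReal_le.2 (one_le_lowSumCusum x)
  · set m := ⌊w / (4 * D)⌋₊ with hm
    have hm1 : (m : ℝ) ≤ w / (4 * D) := Nat.floor_le (by positivity)
    have hm2 : w / (4 * D) < m + 1 := Nat.lt_floor_add_one _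
    have hm3 : 1 ≤ w / (4 * D) := by rwa [one_le_div (by positivity)]
    have hP : honestLaw lam f g N ∅ ⊤ {x | lowSumCusum f g L h x ≤ m} ≤ ENNReal.ofReal (1 / 2) := by
      refine (measure_mono fun x hx => ?_).trans ((hD (N.card / L * h) m).trans
        (ENNReal.ofReal_le_ofReal ?_))
      · simpa using exists_le_prod_univ_of_lowSumCusum_le hL1 hLc hx
      · rw [Real.exp_neg, ← hw]
        calc ((m : ℝ) + 1) * (D * w⁻¹) ≤ (2 * (w / (4 * D))) * (D * w⁻¹) := by
              gcongr; linarith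
          _ = 1 / 2 := by field_simp; norm_num
    refine le_trans ?_ (succ_mul_one_sub_le_lintegral _ (measurableSet_lowSumCusum_le hf hg hLc m))
    calc ENNReal.ofReal (w / (8 * D)) ≤ ENNReal.ofReal ((m + 1) * (1 - 1 / 2)) := by
          refine ENNReal.ofReal_le_ofReal ?_
          have : w / (8 * D) = w / (4 * D) / 2 := by field_simp; norm_num
          rw [this]; linarith
      _ = ((m + 1 : ℕ) : ℝ≥0∞) * (1 - ENNReal.ofReal (1 / 2)) := by
          rw [ENNReal.ofReal_mul (by positivity), ENNReal.ofReal_sub _ (by norm_num),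
            ENNReal.ofReal_one, ← Nat.cast_succ, ENNReal.ofReal_natCast]
      _ ≤ _ := by gcongr

theorem exists_lintegral_lowSumCusum_le (hf : Measurable f) (hg : Measurable g)
    (H : IsLikelihoodRatio (densityMeasure lam f) (densityMeasure lam g) (likelihoodRatio f g) I)
    (hL1 : 1 ≤ L) (hL : L ≤ N.card) {δ : ℝ} (hδ0 : 0 < δ) (hδ1 : δ < 1) :
    ∃ C : ℝ, ∀ h : ℝ, 0 < h →
      ∫⁻ x, (lowSumCusum f g L h x : ℝ≥0∞) ∂(honestLaw lam f g N ∅ ⊤) ≤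
        ENNReal.ofReal (Real.exp ((1 + 2 * δ) / (1 - δ) * (N.card / L * h) + C)) := by
  obtain ⟨m₀, hm₀⟩ := eventually_atTop.1 (H.eventually_le_measure_le_prod hδ0)
  have hI := H.pos
  have h1δ : 0 < 1 - δ := by linarith
  have hn0 : (0 : ℝ) < N.card := by exact_mod_cast (by omega : 0 < N.card)
  have hLr : (0 : ℝ) < L := by exact_mod_cast hL1
  set n : ℝ := (N.card : ℝ) with hn
  -- The prefactor `m` is absorbed through m ≤ exp(q m)/q; this raises 1 + δ to 1 + 2δ in the
  -- exponent.
  set q := n * I * δ with hq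
  have hq0 : 0 < q := by positivity
  refine ⟨n * I * (1 + 2 * δ) * (m₀ + 2) + Real.log (2 ^ N.card / q), fun h hh => ?_⟩
  -- The ceiling makes m I (1 - δ) at least h/L; adding `m₀ + 1` makes the eventual estimate
  -- applicable and `m` positive.
  set m := m₀ + 1 + ⌈h / (L * (I * (1 - δ)))⌉₊ with hm
  have hmlow : h / L ≤ m * (I * (1 - δ)) := by
    have h1 : h / (L * (I * (1 - δ))) ≤ m := by
      rw [hm]; push_cast
      linarith [Nat.le_ceil (h / (L * (I * (1 - δ)))), (Nat.cast_nonneg m₀ : (0 : ℝ) ≤ m₀)]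
    calc h / L = h / (L * (I * (1 - δ))) * (I * (1 - δ)) := by field_simp
      _ ≤ _ := by gcongr
  have hmup : (m : ℝ) ≤ h / (L * (I * (1 - δ))) + (m₀ + 2) := by
    rw [hm]; push_cast
    linarith [(Nat.ceil_lt_add_one (by positivity : 0 ≤ h / (L * (I * (1 - δ)))))]
  refine (lintegral_lowSumCusum_le hf hg hL1 hL hh.le (m := m) (by omega)).trans ?_
  have hp : ENNReal.ofReal (2⁻¹ * Real.exp (-(m * (I * (1 + δ))))) ≤
      Measure.infinitePi (fun _ : ℕ => densityMeasure lam f)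
        {x | ENNReal.ofReal (Real.exp (h / L)) ≤
          ∏ i ∈ Finset.range m, likelihoodRatio f g (x i)} := by
    refine (hm₀ m (by omega)).trans (measure_mono fun x hx => ?_)
    exact le_trans (ENNReal.ofReal_le_ofReal (Real.exp_le_exp.2 hmlow)) hx
  have hmq : (m : ℝ) ≤ Real.exp (q * m) / q := by
    rw [le_div_iff₀ hq0]
    linarith [Real.add_one_le_exp (q * m)]
  calc _ ≤ (m : ℝ≥0∞) *
        (ENNReal.ofReal (2⁻¹ * Real.exp (-(m * (I * (1 + δ))))) ^ N.card)⁻¹ := by gcongr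
    _ = ENNReal.ofReal (m * (2 ^ N.card * Real.exp (n * (m * (I * (1 + δ)))))) := by
      rw [← ENNReal.ofReal_pow (by positivity), ← ENNReal.ofReal_inv_of_pos (by positivity),
        ENNReal.ofReal_mul (Nat.cast_nonneg m), ENNReal.ofReal_natCast]
      congr 2
      rw [mul_pow, mul_inv, inv_pow, inv_inv, ← Real.exp_nat_mul, ← Real.exp_neg, ← hn]
      congr 2
      ring
    _ ≤ _ := by
      refine ENNReal.ofReal_le_ofReal ?_
      calc (m : ℝ) * (2 ^ N.card * Real.exp (n * (m * (I * (1 + δ)))))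
          ≤ Real.exp (q * m) / q * (2 ^ N.card * Real.exp (n * (m * (I * (1 + δ))))) := by gcongr
        _ = Real.exp (n * I * (1 + 2 * δ) * m + Real.log (2 ^ N.card / q)) := by
          rw [Real.exp_add, Real.exp_log (by positivity), show n * I * (1 + 2 * δ) * m =
            q * m + n * (m * (I * (1 + δ))) by rw [hq]; ring, Real.exp_add]
          ring
        _ ≤ _ := by
          refine Real.exp_le_exp.2 ?_
          have h1 : n * I * (1 + 2 * δ) * m ≤
              n * I * (1 + 2 * δ) * (h / (L * (I * (1 - δ))) + (m₀ + 2)) := by gcongr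
          have h2 : n * I * (1 + 2 * δ) * (h / (L * (I * (1 - δ)))) =
              (1 + 2 * δ) / (1 - δ) * (n / L * h) := by field_simp
          have h3 := h1.trans_eq (mul_add _ _ _)
          rw [h2] at h3
          linarith

theorem exists_detectionDelay_le (hf : Measurable f) (hg : Measurable g)
    (H : IsLikelihoodRatio (densityMeasure lam f) (densityMeasure lam g) (likelihoodRatio f g) I)
    (hB : B ⊆ N) (hLK : L ≤ K) {r : ℕ} (hr : L + B.card - K = r) (hr1 : 1 ≤ r) {δ : ℝ}
    (hδ0 : 0 < δ) (hδ1 : δ < 1) :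
    ∃ C : ℝ, ∀ h : ℝ, 0 < h → detectionDelay lam f g N B (lowSumCusum (ι := Fin K) f g L h) ≤
      ENNReal.ofReal (h / (r * I) / (1 - δ) ^ 2 + C) := by
  have hI := H.pos
  have h1δ : 0 < 1 - δ := by linarith
  have hr0 : (0 : ℝ) < r := by exact_mod_cast hr1
  have hlim := (ENNReal.Tendsto.pow (n := B.card) (H.tendsto_measure_le_prod hδ0))
  rw [one_pow] at hlim
  obtain ⟨m₀, hm₀⟩ := eventually_atTop.1 ((tendsto_order.1 hlim).1 (ENNReal.ofReal (1 - δ))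
    (by rw [ENNReal.ofReal_lt_one]; linarith))
  refine ⟨(m₀ + 2) / (1 - δ), fun h hh => ?_⟩
  set m := m₀ + 1 + ⌈h / r / (I * (1 - δ))⌉₊ with hm
  have hmlow : h / r ≤ m * (I * (1 - δ)) := by
    have h1 : h / r / (I * (1 - δ)) ≤ m := by
      rw [hm]; push_cast
      linarith [Nat.le_ceil (h / r / (I * (1 - δ))), (Nat.cast_nonneg m₀ : (0 : ℝ) ≤ m₀)]
    rwa [div_le_iff₀ (by positivity)] at h1
  have hmup : (m : ℝ) ≤ h / r / (I * (1 - δ)) + (m₀ + 2) := by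
    rw [hm]; push_cast
    linarith [(Nat.ceil_lt_add_one (by positivity : 0 ≤ h / r / (I * (1 - δ))))]
  refine (detectionDelay_le hf hg hB hLK (c := h / r) (by positivity)
    (by rw [hr]; field_simp) (m := m) (by omega)).trans ?_
  have hp : ENNReal.ofReal (1 - δ) ≤ Measure.infinitePi (fun _ : ℕ => densityMeasure lam g)
        {x | ENNReal.ofReal (Real.exp (h / r)) ≤
          ∏ i ∈ Finset.range m, likelihoodRatio f g (x i)} ^ B.card := by
    refine (hm₀ m (by omega)).le.trans (pow_le_pow_left' (measure_mono fun x hx => ?_) _)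
    exact le_trans (ENNReal.ofReal_le_ofReal (Real.exp_le_exp.2 hmlow)) hx
  calc _ ≤ (m : ℝ≥0∞) * (ENNReal.ofReal (1 - δ))⁻¹ := by gcongr
    _ = ENNReal.ofReal (m * (1 - δ)⁻¹) := by
      rw [← ENNReal.ofReal_inv_of_pos h1δ, ENNReal.ofReal_mul (Nat.cast_nonneg m),
        ENNReal.ofReal_natCast]
    _ ≤ _ := by
      refine ENNReal.ofReal_le_ofReal ?_
      calc (m : ℝ) * (1 - δ)⁻¹ ≤ (h / r / (I * (1 - δ)) + (m₀ + 2)) * (1 - δ)⁻¹ := by gcongr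
        _ = _ := by field_simp

/-- The strategy of the adversary whose sensors always observe `x₀`. -/
def constStrategy (N : Finset (Fin K)) (x₀ : 𝒳) : Strategy 𝒳 N where
  act _ _ _ := x₀
  measurable_act _ := measurable_const

/-- Take change-point 0: the essential supremum of a conditional expectation dominates its mean,
which is the unconditional one. -/
theorem lintegral_le_detectionDelay (π : Strategy 𝒳 N) (hf : Measurable f) (hg : Measurable g)
    (hLK : L ≤ K) (h : ℝ) :
    ∫⁻ x, (lowSumCusum f g L h (observe π x) : ℝ≥0∞) ∂(honestLaw lam f g N B (0 : ℕ)) ≤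
      detectionDelay lam f g N B (lowSumCusum (ι := Fin K) f g L h) := by
  have hm := measurable_lowSumCusum_toENNReal (h := h) hf hg hLK 0
  refine le_trans ?_ (le_iSup₂ (f := fun (nu : ℕ) (π : Strategy 𝒳 N) =>
    essSup (condLExp (obsFiltration 𝒳 K nu) (sensorLaw lam f g N B nu π)
      fun x => ((lowSumCusum f g L h x - (nu : ℕ∞) : ℕ∞) : ℝ≥0∞))
      (sensorLaw lam f g N B nu π)) 0 π)
  have h1 := lintegral_sensorLaw (lam := lam) (f := f) (g := g) (B := B) (0 : ℕ) π hm
  have h2 := lintegral_condLExp ((obsFiltration 𝒳 K).le 0) (sensorLaw lam f g N B (0 : ℕ) π)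
    fun x => ((lowSumCusum f g L h x - ((0 : ℕ) : ℕ∞) : ℕ∞) : ℝ≥0∞)
  rw [h1] at h2
  simp only [Nat.cast_zero, tsub_zero] at h2 ⊢
  rw [← h2]
  refine (lintegral_mono_ae (ENNReal.ae_le_essSup _)).trans ?_
  simp

lemma exists_le_prod_of_lowSumCusum_constStrategy_le {x₀ : 𝒳} (hx₀ : likelihoodRatio f g x₀ ≤ 1)
    {B' : Finset (Fin K)} (hB' : B' ⊆ B) (hcard : B'.card + K = L + B.card) (hBN : B ⊆ N) {h c : ℝ}
    {m : ℕ} {x : ℕ → N → 𝒳}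
    (hm : lowSumCusum f g L h (observe (constStrategy N x₀) x) ≤ m)
    (hx : ∀ k ∈ B'.subtype (· ∈ N), ∀ t ≤ m,
      expCusum (likelihoodRatio f g) (fun i => x i k) t ≤ ENNReal.ofReal (Real.exp c)) :
    ∃ t ≤ m, ENNReal.ofReal (Real.exp (h - B'.card * c)) ≤
      ∏ k ∈ Bᶜ.subtype (· ∈ N), expCusum (likelihoodRatio f g) (fun i => x i k) t := by
  classical
  have hdisj : Disjoint Bᶜ B' := (disjoint_compl_left (a := B)).mono_right hB'
  have hbK : B.card ≤ K := by simpa using B.card_le_univ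
  -- This set has K - |B| + r = L elements, so its sum of statistics dominates the stopping
  -- statistic.
  obtain ⟨t, htm, ht⟩ := exists_le_prod_of_lowSumCusum_le hm (s := Bᶜ ∪ B') (by
    rw [Finset.card_union_of_disjoint hdisj, Finset.card_compl, Fintype.card_fin]; omega)
  refine ⟨t, htm, ?_⟩
  set R : Fin K → ℝ≥0∞ := fun k =>
    expCusum (likelihoodRatio f g) (fun i => observe (constStrategy N x₀) x i k) t with hR
  have hRN : ∀ k : N, R k = expCusum (likelihoodRatio f g) (fun i => x i k) t := fun k => by
    simp [hR, observe]
  have h1 : ∏ k ∈ B', R k ≤ ENNReal.ofReal (Real.exp (B'.card * c)) := by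
    rw [Real.exp_nat_mul, ENNReal.ofReal_pow (Real.exp_pos _).le]
    refine Finset.prod_le_pow_card _ _ _ fun k hk => ?_
    have hkN := hBN (hB' hk)
    have := hx ⟨k, hkN⟩ (by simpa using hk) t htm
    rwa [← hRN] at this
  have h2 : ∏ k ∈ Bᶜ, R k ≤ ∏ k ∈ Bᶜ.subtype (· ∈ N), R k := by
    rw [Finset.prod_subtype_eq_prod_filter,
      ← Finset.prod_filter_mul_prod_filter_not Bᶜ (· ∈ N)]
    refine mul_le_of_le_one_right' (Finset.prod_le_one' fun k hk => ?_)
    have hkN : k ∉ N := (Finset.mem_filter.1 hk).2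
    refine expCusum_le_one _ (fun i => ?_) t
    simpa [observe, hkN, constStrategy] using hx₀
  have h3 : ENNReal.ofReal (Real.exp h) ≤
      (∏ k ∈ Bᶜ.subtype (· ∈ N), R k) * ENNReal.ofReal (Real.exp (B'.card * c)) := by
    refine ht.trans ?_
    rw [Finset.prod_union hdisj]
    exact mul_le_mul' h2 h1
  simp only [hRN] at h3
  rw [Real.exp_sub, ENNReal.ofReal_div_of_pos (Real.exp_pos _)]
  exact ENNReal.div_le_of_le_mul h3

theorem eventually_le_detectionDelay (hf : Measurable f) (hg : Measurable g)
    (H : IsLikelihoodRatio (densityMeasure lam f) (densityMeasure lam g) (likelihoodRatio f g) I)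
    {x₀ : 𝒳} (hx₀ : likelihoodRatio f g x₀ ≤ 1) (hB : B ⊆ N) (hLK : L ≤ K) {r : ℕ}
    (hr : r + K = L + B.card) (hr1 : 1 ≤ r) {δ : ℝ} (hδ0 : 0 < δ) (hδ1 : δ < 1) :
    ∀ᶠ h : ℝ in atTop, ENNReal.ofReal ((1 - δ) ^ 2 * (h / (r * I))) ≤
      detectionDelay lam f g N B (lowSumCusum (ι := Fin K) f g L h) := by
  classical
  have hI := H.pos
  have h1δ : 0 < 1 - δ := by linarith
  have hr0 : (0 : ℝ) < r := by exact_mod_cast hr1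
  obtain ⟨B', hB'B, hB'c⟩ := Finset.exists_subset_card_eq (by omega : r ≤ B.card)
  set P := honestMarginal lam f g N B (0 : ℕ) with hP
  set s : Finset N := B'.subtype (· ∈ N) with hs
  have hscard : s.card = r := by
    rw [hs, Finset.card_subtype, Finset.filter_true_of_mem fun k hk => hB (hB'B hk), hB'c]
  obtain ⟨D, hD1, hD⟩ := H.exists_jointLaw_prod_expCusum_le P (s := Bᶜ.subtype (· ∈ N))
    (fun t k hk => by
      have : (k : Fin K) ∉ B := by simpa using hk
      simp [hP, honestMarginal, this]) (θ := 1 / 2) (by norm_num) (by norm_num)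
  set E : ℕ → Set (ℕ → 𝒳) := fun m => {x | ∀ t ≤ m,
    expCusum (likelihoodRatio f g) x t ≤ ENNReal.ofReal (Real.exp (m * (I * (1 + δ))))} with hE
  have hEm : ∀ m, MeasurableSet (E m) := fun m =>
    measurableSet_forall_expCusum_le H.measurable _ _
  set Q := Measure.infinitePi fun _ : ℕ => densityMeasure lam g with hQ
  -- Up to this time the r sensors of `B'` contribute at most (1 - δ)(1 + δ) h, leaving at least δ²
  -- h for the unaffected honest sensors, an event of exponentially small probability times a linear
  -- factor.
  set M : ℝ → ℕ := fun h => ⌊(1 - δ) * (h / (r * I))⌋₊ with hM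
  have hMtop : Tendsto M atTop atTop := by
    refine tendsto_nat_floor_atTop.comp (Tendsto.const_mul_atTop h1δ ?_)
    exact tendsto_id.atTop_div_const (by positivity)
  have hbound : ∀ h : ℝ, 0 < h → jointLaw P {x | lowSumCusum f g L h
      (observe (constStrategy N x₀) x) ≤ M h} ≤ r * (1 - Q (E (M h))) +
        ENNReal.ofReal (((1 - δ) * (h / (r * I)) + 1) * (D * Real.exp (-(1 / 2 * (δ ^ 2 * h))))) := by
    intro h hh
    have hMh : (M h : ℝ) ≤ (1 - δ) * (h / (r * I)) := Nat.floor_le (by positivity)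
    have hexp : δ ^ 2 * h ≤ h - B'.card * (M h * (I * (1 + δ))) := by
      rw [hB'c]
      have : (r : ℝ) * (M h * (I * (1 + δ))) ≤
          r * ((1 - δ) * (h / (r * I)) * (I * (1 + δ))) := by gcongr
      have h2 : (r : ℝ) * ((1 - δ) * (h / (r * I)) * (I * (1 + δ))) = (1 - δ ^ 2) * h := by
        field_simp; ring
      linarith
    have hsub : {x : ℕ → N → 𝒳 | lowSumCusum f g L h (observe (constStrategy N x₀) x) ≤ M h} ⊆
        (⋃ k ∈ s, {x : ℕ → N → 𝒳 | (fun i => x i k) ∈ (E (M h))ᶜ}) ∪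
        {x | ∃ t ≤ M h, ENNReal.ofReal (Real.exp (δ ^ 2 * h)) ≤
          ∏ k ∈ Bᶜ.subtype (· ∈ N), expCusum (likelihoodRatio f g) (fun i => x i k) t} := by
      intro x hx
      by_cases hxE : ∀ k ∈ s, (fun i => x i k) ∈ E (M h)
      · right
        obtain ⟨t, ht, hxt⟩ := exists_le_prod_of_lowSumCusum_constStrategy_le hx₀ hB'B
          (by omega) hB hx (c := M h * (I * (1 + δ))) fun k hk t ht => hxE k hk t ht
        exact ⟨t, ht, (ENNReal.ofReal_le_ofReal (Real.exp_le_exp.2 hexp)).trans hxt⟩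
      · left
        push Not at hxE
        obtain ⟨k, hk, hxk⟩ := hxE
        exact Set.mem_biUnion (Finset.mem_coe.2 hk) hxk
    refine (measure_mono hsub).trans ((measure_union_le _ _).trans (add_le_add ?_ ?_))
    · refine (measure_biUnion_finset_le _ _).trans ?_
      rw [← hscard, ← nsmul_eq_mul]
      refine Finset.sum_le_card_nsmul _ _ _ fun k hk => ?_
      rw [jointLaw_mem P k (hEm _).compl]
      have hkB : (k : Fin K) ∈ B := hB'B (by simpa [hs] using hk)
      have : (fun i => P i k) = fun _ => densityMeasure lam g := by
        funext i
        rw [hP, honestMarginal, if_pos]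
        exact ⟨hkB, by exact_mod_cast Nat.succ_pos i⟩
      rw [this, prob_compl_eq_one_sub (hEm _)]
    · refine (hD (δ ^ 2 * h) (M h)).trans (ENNReal.ofReal_le_ofReal ?_)
      gcongr
  have hlim : Tendsto (fun h : ℝ => (r : ℝ≥0∞) * (1 - Q (E (M h))) +
        ENNReal.ofReal (((1 - δ) * (h / (r * I)) + 1) *
          (D * Real.exp (-(1 / 2 * (δ ^ 2 * h)))))) atTop (𝓝 0) := by
    have h1 : Tendsto (fun h : ℝ => (r : ℝ≥0∞) * (1 - Q (E (M h)))) atTop (𝓝 0) := by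
      have h2 := (H.tendsto_measure_expCusum_le hδ0).comp hMtop
      have h3 := ENNReal.Tendsto.const_mul (a := (r : ℝ≥0∞))
        (ENNReal.Tendsto.sub tendsto_const_nhds h2 (Or.inl ENNReal.one_ne_top))
        (Or.inr (ENNReal.natCast_ne_top r))
      simpa [Function.comp_def] using h3
    have h4 : Tendsto (fun h : ℝ => ((1 - δ) * (h / (r * I)) + 1) *
        (D * Real.exp (-(1 / 2 * (δ ^ 2 * h))))) atTop (𝓝 0) := by
      have hb : 0 < 1 / 2 * δ ^ 2 := by positivity
      have h5 := (Real.tendsto_pow_mul_exp_neg_atTop_nhds_zero 1).comp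
        (tendsto_id.const_mul_atTop hb)
      have h6 := (Real.tendsto_pow_mul_exp_neg_atTop_nhds_zero 0).comp
        (tendsto_id.const_mul_atTop hb)
      have h7 := (h5.const_mul ((1 - δ) / (r * I) * D / (1 / 2 * δ ^ 2))).add (h6.const_mul D)
      simp only [mul_zero, add_zero] at h7
      refine h7.congr fun h => ?_
      simp only [Function.comp_apply, id_eq, pow_one, pow_zero, one_mul]
      rw [show -(1 / 2 * (δ ^ 2 * h)) = -(1 / 2 * δ ^ 2 * h) by ring]
      field_simp
    have h8 := (ENNReal.continuous_ofReal.tendsto 0).comp h4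
    have h9 := h1.add h8
    simpa [Function.comp_def] using h9
  filter_upwards [(tendsto_order.1 hlim).2 (ENNReal.ofReal δ) (by simpa using hδ0),
    eventually_gt_atTop 0] with h hsmall hh
  have hmeas : MeasurableSet {x : ℕ → N → 𝒳 | lowSumCusum f g L h
      (observe (constStrategy N x₀) x) ≤ M h} :=
    measurable_observe _ (measurableSet_lowSumCusum_le hf hg (by simpa using hLK) (M h))
  refine le_trans ?_ (lintegral_le_detectionDelay (constStrategy N x₀) hf hg hLK h)
  refine le_trans ?_ (succ_mul_one_sub_le_lintegral _ hmeas)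
  have hT := (hbound h hh).trans hsmall.le
  have hMh : (1 - δ) * (h / (r * I)) < M h + 1 := Nat.lt_floor_add_one _
  calc ENNReal.ofReal ((1 - δ) ^ 2 * (h / (r * I)))
      ≤ ENNReal.ofReal ((M h + 1) * (1 - δ)) := by
        refine ENNReal.ofReal_le_ofReal ?_
        nlinarith
    _ = ((M h + 1 : ℕ) : ℝ≥0∞) * (1 - ENNReal.ofReal δ) := by
        rw [ENNReal.ofReal_mul (by positivity), ENNReal.ofReal_sub _ hδ0.le, ENNReal.ofReal_one,
          ← Nat.cast_succ, ENNReal.ofReal_natCast]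
    _ ≤ _ := by
        gcongr
        exact hT

end Bounds

/-! ### Letting γ tend to infinity and then δ to 0. -/

section Asymptotics

variable {Γ : Set ℝ} {h : ℝ → ℝ} {J : ℝ → ℝ≥0∞} {a d : ℝ}

lemma eventually_div_log_le (C : ℝ) {δ : ℝ} (hδ : 0 < δ) :
    ∀ᶠ γ : ℝ in atTop, 0 < Real.log γ ∧ C / Real.log γ ≤ δ := by
  filter_upwards [Real.tendsto_log_atTop.eventually_ge_atTop (C / δ),
    Real.tendsto_log_atTop.eventually_gt_atTop 0] with γ h1 h2
  refine ⟨h2, ?_⟩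
  rw [div_le_iff₀ hδ] at h1
  rw [div_le_iff₀ h2]
  linarith

lemma eventually_div_log_le_of_le (ha : 0 < a) (hd : 0 < d) (hh_pos : ∀ γ ∈ Γ, 0 < h γ) {δ : ℝ}
    (hδ0 : 0 < δ) (hδ1 : δ < 1)
    (h2 : ∃ C, ∀ γ ∈ Γ, 0 < γ → (1 - δ) * (a * h γ) - C ≤ Real.log γ)
    (h3 : ∃ C, ∀ t, 0 < t → J t ≤ ENNReal.ofReal (t / d / (1 - δ) ^ 2 + C)) :
    ∀ᶠ γ in atTop ⊓ 𝓟 Γ, J (h γ) / ENNReal.ofReal (a⁻¹ * (Real.log γ / d)) ≤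
      ENNReal.ofReal (((1 - δ) ^ 3)⁻¹ + δ) := by
  obtain ⟨C₂, hC₂⟩ := h2
  obtain ⟨C₃, hC₃⟩ := h3
  have h1δ : 0 < 1 - δ := by linarith
  rw [eventually_inf_principal]
  filter_upwards [eventually_div_log_le (((1 - δ) ^ 3)⁻¹ * C₂ + C₃ * d * a) hδ0,
    eventually_gt_atTop 0] with γ hγ hγ0 hγΓ
  obtain ⟨hl, hγ⟩ := hγ
  set l := Real.log γ
  have hhγ : h γ ≤ (l + C₂) / ((1 - δ) * a) := by
    rw [le_div_iff₀ (by positivity)]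
    linarith [hC₂ γ hγΓ hγ0]
  refine (ENNReal.div_le_div_right (hC₃ _ (hh_pos γ hγΓ)) _).trans ?_
  rw [← ENNReal.ofReal_div_of_pos (by positivity)]
  refine ENNReal.ofReal_le_ofReal ?_
  calc (h γ / d / (1 - δ) ^ 2 + C₃) / (a⁻¹ * (l / d))
      ≤ ((l + C₂) / ((1 - δ) * a) / d / (1 - δ) ^ 2 + C₃) / (a⁻¹ * (l / d)) := by gcongr
    _ = ((1 - δ) ^ 3)⁻¹ + (((1 - δ) ^ 3)⁻¹ * C₂ + C₃ * d * a) / l := by field_simp; ring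
    _ ≤ _ := by gcongr

lemma eventually_le_div_log_of_le (ha : 0 < a) (hd : 0 < d) {δ : ℝ} (hδ0 : 0 < δ) (hδ1 : δ < 1)
    (h1 : ∃ C, ∀ γ ∈ Γ, 0 < γ → Real.log γ ≤ (1 + 2 * δ) / (1 - δ) * (a * h γ) + C)
    (h4 : ∀ᶠ t in atTop, ENNReal.ofReal ((1 - δ) ^ 2 * (t / d)) ≤ J t) :
    ∀ᶠ γ in atTop ⊓ 𝓟 Γ, ENNReal.ofReal ((1 - δ) ^ 3 / (1 + 2 * δ) - δ) ≤
      J (h γ) / ENNReal.ofReal (a⁻¹ * (Real.log γ / d)) := by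
  obtain ⟨C₁, hC₁⟩ := h1
  obtain ⟨t₀, ht₀⟩ := eventually_atTop.1 h4
  have h1δ : 0 < 1 - δ := by linarith
  set κ := (1 + 2 * δ) / (1 - δ) * a with hκ
  have hκ0 : 0 < κ := by positivity
  rw [eventually_inf_principal]
  filter_upwards [eventually_div_log_le ((1 - δ) ^ 3 / (1 + 2 * δ) * C₁) hδ0,
    Real.tendsto_log_atTop.eventually_ge_atTop (t₀ * κ + C₁), eventually_gt_atTop 0]
    with γ hγ hγt hγ0 hγΓ
  obtain ⟨hl, hγ⟩ := hγ
  have hC := hC₁ γ hγΓ hγ0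
  rw [← mul_assoc, ← hκ] at hC
  set l := Real.log γ
  have hhγ : (l - C₁) / κ ≤ h γ := by
    rw [div_le_iff₀ hκ0]
    linarith
  -- The lower bound on `J` holds only for large thresholds, so the upper bound on log γ is also
  -- needed here to force `h γ` to be large.
  have hht : t₀ ≤ h γ := by
    refine le_trans ?_ hhγ
    rw [le_div_iff₀ hκ0]
    linarith
  refine le_trans ?_ (ENNReal.div_le_div_right (ht₀ _ hht) _)
  rw [← ENNReal.ofReal_div_of_pos (by positivity)]
  refine ENNReal.ofReal_le_ofReal ?_
  calc (1 - δ) ^ 3 / (1 + 2 * δ) - δ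
      ≤ (1 - δ) ^ 3 / (1 + 2 * δ) - ((1 - δ) ^ 3 / (1 + 2 * δ) * C₁) / l := by gcongr
    _ = (1 - δ) ^ 2 * ((l - C₁) / κ / d) / (a⁻¹ * (l / d)) := by rw [hκ]; field_simp
    _ ≤ _ := by gcongr

theorem tendsto_div_log_of_bounds (ha : 0 < a) (hd : 0 < d) (hh_pos : ∀ γ ∈ Γ, 0 < h γ)
    (h1 : ∀ δ, 0 < δ → δ < 1 →
      ∃ C, ∀ γ ∈ Γ, 0 < γ → Real.log γ ≤ (1 + 2 * δ) / (1 - δ) * (a * h γ) + C)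
    (h2 : ∀ δ, 0 < δ → δ < 1 →
      ∃ C, ∀ γ ∈ Γ, 0 < γ → (1 - δ) * (a * h γ) - C ≤ Real.log γ)
    (h3 : ∀ δ, 0 < δ → δ < 1 →
      ∃ C, ∀ t, 0 < t → J t ≤ ENNReal.ofReal (t / d / (1 - δ) ^ 2 + C))
    (h4 : ∀ δ, 0 < δ → δ < 1 →
      ∀ᶠ t in atTop, ENNReal.ofReal ((1 - δ) ^ 2 * (t / d)) ≤ J t) :
    Tendsto (fun γ => J (h γ) / ENNReal.ofReal (a⁻¹ * (Real.log γ / d)))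
      (atTop ⊓ 𝓟 Γ) (𝓝 1) := by
  have hmem : ∀ᶠ δ : ℝ in 𝓝[>] 0, 0 < δ ∧ δ < 1 :=
    Ioo_mem_nhdsGT (by norm_num : (0 : ℝ) < 1)
  refine tendsto_order.2 ⟨fun b hb => ?_, fun b hb => ?_⟩
  · have hcont : Tendsto (fun δ : ℝ => ENNReal.ofReal ((1 - δ) ^ 3 / (1 + 2 * δ) - δ))
        (𝓝[>] 0) (𝓝 1) := by
      have : ContinuousAt (fun δ : ℝ => (1 - δ) ^ 3 / (1 + 2 * δ) - δ) 0 :=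
        ContinuousAt.sub (ContinuousAt.div (by fun_prop) (by fun_prop) (by norm_num)) (by fun_prop)
      have h5 := ENNReal.tendsto_ofReal this.tendsto
      norm_num at h5
      exact h5.mono_left nhdsWithin_le_nhds
    obtain ⟨δ, hδb, hδ0, hδ1⟩ := (((tendsto_order.1 hcont).1 b hb).and hmem).exists
    filter_upwards [eventually_le_div_log_of_le ha hd hδ0 hδ1 (h1 δ hδ0 hδ1) (h4 δ hδ0 hδ1)]
      with γ hγ using hδb.trans_le hγ
  · have hcont : Tendsto (fun δ : ℝ => ENNReal.ofReal (((1 - δ) ^ 3)⁻¹ + δ))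
        (𝓝[>] 0) (𝓝 1) := by
      have : ContinuousAt (fun δ : ℝ => ((1 - δ) ^ 3)⁻¹ + δ) 0 :=
        ContinuousAt.add (ContinuousAt.inv₀ (by fun_prop) (by norm_num)) (by fun_prop)
      have h5 := ENNReal.tendsto_ofReal this.tendsto
      norm_num at h5
      exact h5.mono_left nhdsWithin_le_nhds
    obtain ⟨δ, hδb, hδ0, hδ1⟩ := (((tendsto_order.1 hcont).2 b hb).and hmem).exists
    filter_upwards [eventually_div_log_le_of_le ha hd hh_pos hδ0 hδ1 (h2 δ hδ0 hδ1)
      (h3 δ hδ0 hδ1)] with γ hγ using hγ.trans_lt hδb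

end Asymptotics

end ByzantineCUSUM

/-! ### Assembly, with a = n/L and d = r I. -/

theorem mainTheorem1 {𝒳 : Type*} [MeasurableSpace 𝒳]
    (lam : Measure 𝒳) [SigmaFinite lam] (f g : 𝒳 → ℝ≥0)
    (hf : Measurable f) (hg : Measurable g)
    (hf_int : ∫⁻ x, (f x : ℝ≥0∞) ∂lam = 1) (hg_int : ∫⁻ x, (g x : ℝ≥0∞) ∂lam = 1)
    (hI_pos : 0 < ByzantineCUSUM.klNumber lam f g)
    (hI_fin : ByzantineCUSUM.klNumber lam f g < ⊤)
    (K M L : ℕ) (N B : Finset (Fin K))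
    (hN : N.card + M = K) (hB : B ⊆ N)
    (hL_one : 1 ≤ L) (hL : L ≤ K - M)
    (Γ : Set ℝ) (h : ℝ → ℝ) (hh_pos : ∀ γ ∈ Γ, 0 < h γ)
    (hh : ∀ γ ∈ Γ,
      ∫⁻ x, (ByzantineCUSUM.lowSumCusum f g L (h γ) x : ℝ≥0∞)
        ∂(ByzantineCUSUM.honestLaw lam f g N ∅ ⊤) = ENNReal.ofReal γ) :
    (∀ γ ∈ Γ, ByzantineCUSUM.lowSumCusum (ι := Fin K) f g L (h γ) ∈
      ByzantineCUSUM.ruleClass lam f g N γ) ∧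
    (K - B.card < L →
      Tendsto
        (fun γ : ℝ =>
          ByzantineCUSUM.detectionDelay lam f g N B
              (ByzantineCUSUM.lowSumCusum (ι := Fin K) f g L (h γ)) /
            ENNReal.ofReal ((L : ℝ) / ((K : ℝ) - (M : ℝ)) *
              (Real.log γ / (((B.card : ℝ) - ((K : ℝ) - (L : ℝ))) *
                (ByzantineCUSUM.klNumber lam f g).toReal))))
        (atTop ⊓ 𝓟 Γ) (𝓝 1)) := by
  open ByzantineCUSUM in
  have := isProbabilityMeasure_densityMeasure hf_int
  have := isProbabilityMeasure_densityMeasure hg_int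
  obtain ⟨x₀, hx₀⟩ := exists_likelihoodRatio_le_one hg hf_int hg_int
  have : Nonempty 𝒳 := ⟨x₀⟩
  have H := isLikelihoodRatio_densityMeasure hf hg hf_int hg_int hI_pos hI_fin
  have hLN : L ≤ N.card := by omega
  have hLK : L ≤ K := by omega
  refine ⟨fun γ hγ => lowSumCusum_mem_ruleClass hf hg hLN (hh γ hγ), fun hBL => ?_⟩
  have hBK : B.card ≤ K := by simpa using B.card_le_univ
  obtain ⟨r, hr⟩ : ∃ r, r + K = L + B.card := ⟨L + B.card - K, by omega⟩
  have hr1 : 1 ≤ r := by omega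
  have hI := H.pos
  have hL0 : (0 : ℝ) < L := by exact_mod_cast hL_one
  have hr0 : (0 : ℝ) < r := by exact_mod_cast hr1
  have hn0 : (0 : ℝ) < N.card := by exact_mod_cast (by omega : 0 < N.card)
  have hcoef : (L : ℝ) / ((K : ℝ) - (M : ℝ)) = ((N.card : ℝ) / L)⁻¹ := by
    have h1 : (N.card : ℝ) + M = K := by exact_mod_cast hN
    rw [inv_div, ← h1, add_sub_cancel_right]
  have hrr : (B.card : ℝ) - ((K : ℝ) - (L : ℝ)) = r := by
    have : (r : ℝ) + K = L + B.card := by exact_mod_cast hr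
    linarith
  simp only [hcoef, hrr]
  refine tendsto_div_log_of_bounds
    (J := fun t => detectionDelay lam f g N B (lowSumCusum (ι := Fin K) f g L t))
    (by positivity) (by positivity) hh_pos ?_ ?_ ?_ ?_
  · intro δ hδ0 hδ1
    obtain ⟨C, hC⟩ := exists_lintegral_lowSumCusum_le (N := N) hf hg H hL_one hLN hδ0 hδ1
    refine ⟨C, fun γ hγ hγ0 => ?_⟩
    have h1 := hC (h γ) (hh_pos γ hγ)
    rw [hh γ hγ, ENNReal.ofReal_le_ofReal_iff (Real.exp_pos _).le] at h1
    exact (Real.log_le_iff_le_exp hγ0).2 h1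
  · intro δ hδ0 hδ1
    obtain ⟨C, hC⟩ := exists_le_lintegral_lowSumCusum (N := N) hf hg H hL_one hLN
      (θ := 1 - δ) (by linarith) (by linarith)
    refine ⟨C, fun γ hγ hγ0 => ?_⟩
    have h1 := hC (h γ)
    rw [hh γ hγ, ENNReal.ofReal_le_ofReal_iff hγ0.le] at h1
    exact (Real.le_log_iff_exp_le hγ0).2 h1
  · intro δ hδ0 hδ1
    exact exists_detectionDelay_le hf hg H hB hLK (by omega) hr1 hδ0 hδ1
  · intro δ hδ0 hδ1
    exact eventually_le_detectionDelay hf hg H hx₀ hB hLK hr hr1 hδ0 hδ1
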